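/- **Conventions.** Algorithms are partial recursive functions; rationals, pairs, finite lists and programs are numbered effectively. A *computable metric space* is a metric space $(X,d)$ with a dense sequence of ideal points $(s_i)_{i\in\mathbb N}$ whose distances $d(s_i,s_j)$ are computable reals, uniformly in $i,j$. Its ideal balls are $B(s_i,q)$, $0<q\in\mathbb Q$. An open set is *effective* if it is the union of an algorithmically enumerated sequence of ideal balls, and an *effective $G_\delta$-set* is the intersection of a uniformly effective sequence of open sets. In a space with a distance and a numbered family of ideal elements, an element $x$ is *computable* if some algorithm outputs a sequence of ideal elements $x_n$, and some algorithm computes $D(\epsilon)$ for rational $\epsilon>0$, such that $x_n$ is within $\epsilon$ of $x$ for all $n\ge D(\epsilon)$; a *description* of $x$ is such a pair of programs. Let $\mu$ be a Borel probability measure on $X$. - $\mu$ is *computable* if it is so for the distance $W_1(\mu,\nu)=\sup_f|\int f\,d\mu-\int f\,d\nu|$ ($f$ ranging over the bounded $1$-Lipschitz functions), the ideal elements being the finite rational convex combinations of Dirac measures at ideal points. - A map $T:X\to X$ is *almost everywhere computable* if there are an effective $G_\delta$-set $D$ with $\mu(D)=1$ and effective open sets $U_B$, uniform in the ideal ball $B$,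 with $T^{-1}(B)\cap D=U_B\cap D$. A description of $T$ consists of a program for $D$ and a program for $(U_B)_B$. - $f\in L^1(X,\mu)$ is *$L^1(X,\mu)$-computable* if it is computable for the $L^1$ distance, the ideal elements being the finite rational linear combinations of finite products of bump functions $x\mapsto\max(0,1-\max(0,d(x,s_i)-r)/\eta)$, $0<r,\eta\in\mathbb Q$. - $(X,\mu,T)$ is a *computable ergodic system* if $\mu$ is computable and $T$ is almost everywhere computable, measure preserving and ergodic. - Random variables $f_n$ *effectively converge almost surely* to $g$ if there is a computable function $n(\epsilon,\delta)\in\mathbb N$ of rational $\epsilon,\delta>0$ such that $$\mu\Big\{x:\ \sup_{k\ge n}|f_k(x)-g(x)|\ge\epsilon\Big\}<\delta\qquad\text{for all } n\ge n(\epsilon,\delta).$$ **Theorem.** Let $X$ be a computable metric space, $(X,\mu,T)$ a computable ergodic system and $f$ an $L^1(X,\mu)$-computable function. Then the Birkhoff averages $A_n=\frac1n\sum_{k=0}^{n-1}f\circ T^k$ effectively converge almost surely to $\int f\,d\mu$. Moreover, a rate of convergence can be computed from $T,\mu,f$: for each computable metric space $X$ there is a single algorithm which, for every computable ergodic system $(X,\mu,T)$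 and every $L^1(X,\mu)$-computable $f$, given any descriptions of $T$, $\mu$ and $f$ and rational $\epsilon,\delta>0$, halts and outputs a number $n(\epsilon,\delta)$ with the property above for $f_n=A_n$ and $g=\int f\,d\mu$. -/

import Mathlib

open MeasureTheory Set Encodable
open scoped ENNReal
open Nat.Partrec (Code)

noncomputable section

namespace ComputableErgodic

/-! Algorithms are programs `c : Code` for partial recursive functions `c.eval : ℕ →. ℕ`; finite
objects (rationals, pairs, finite lists, programs) are handled through their numbers `encode _`.
Thus `encode y ∈ c.eval (encode x)` says that the algorithm `c` halts on `x` and outputs `y`. -/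

/-- The numbering of `ℚ` is the effective one: the number of `q` is computable from its reduced
numerator and denominator, and conversely. -/
theorem encode_rat (q : ℚ) : encode q = Nat.pair (encode q.num) q.den := rfl

/-- Positive rational numbers, numbered as rational numbers. -/
abbrev PosRat : Type := {q : ℚ // 0 < q}

/-- A computable metric space: a metric space with a numbered dense sequence of ideal points whose
mutual distances are uniformly computable. -/
class ComputableMetricSpace (X : Type*) [MetricSpace X] where
  /-- the ideal points -/
  ideal : ℕ → X
  dense_ideal : DenseRange ideal
  computable_dist : ∃ c : Code, ∀ i j n : ℕ, ∃ q : ℚ,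
    encode q ∈ c.eval (encode (i, j, n)) ∧
      |(q : ℝ) - dist (ideal i) (ideal j)| < (2 : ℝ)⁻¹ ^ n

/-- The pair of programs `p = (a, m)` describes the point `x` of `P`, where `P` carries ideal
points `pt i` and a distance `d`: `a` computes a sequence of ideal points, and `m` computes, for
each rational `ε > 0`, a stage from which on this sequence is within `ε` of `x`. -/
def DescribesPoint {ι P : Type*} [Encodable ι] (pt : ι → P) (d : P → P → ℝ≥0∞)
    (p : Code × Code) (x : P) : Prop :=
  ∃ (A : ℕ → ι) (D : PosRat → ℕ),
    (∀ n, encode (A n) ∈ p.1.eval n) ∧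
    (∀ ε, D ε ∈ p.2.eval (encode ε)) ∧
    ∀ (ε : PosRat) (n : ℕ), D ε ≤ n → d (pt (A n)) x ≤ ENNReal.ofReal ((ε : ℚ) : ℝ)

section Space

variable {X : Type*} [MetricSpace X] [ComputableMetricSpace X]

/-- The ideal ball with number `(i, r)`: its centre is the `i`-th ideal point, its radius is `r`. -/
def idealBall (b : ℕ × PosRat) : Set X :=
  Metric.ball (ComputableMetricSpace.ideal b.1) ((b.2 : ℚ) : ℝ)

/-- The `i`-th member of the uniformly effective sequence of open sets enumerated by the program
`c`: the union over `n` of the ideal balls that `c` outputs on input `(i, n)`. The program need not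
halt on every input. -/
def effectiveOpen {ι : Type*} [Encodable ι] (c : Code) (i : ι) : Set X :=
  {x | ∃ (n : ℕ) (b : ℕ × PosRat), encode b ∈ c.eval (encode (i, n)) ∧ x ∈ idealBall b}

/-- The effective `G_δ`-set given by the program `c`. -/
def effectiveGδ (c : Code) : Set X := ⋂ i : ℕ, effectiveOpen c i

/-- The bump function with number `(i, r, η)`: with `s` the `i`-th ideal point it is `1` on the
ball `B(s, r)`, `0` outside `B(s, r + η)`, and affine in the distance to `s` in between. -/
def bump (b : ℕ × PosRat × PosRat) (x : X) : ℝ :=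
  max 0 (1 - max 0 (dist x (ComputableMetricSpace.ideal b.1) - ((b.2.1 : ℚ) : ℝ)) /
    ((b.2.2 : ℚ) : ℝ))

/-- The ideal elements of `L¹`: finite rational linear combinations of finite products of bump
functions. They are bounded, uniformly computable, and dense in `L¹` of every Borel probability
measure. -/
def idealFun (l : List (ℚ × List (ℕ × PosRat × PosRat))) (x : X) : ℝ :=
  (l.map fun t => (t.1 : ℝ) * (t.2.map fun b => bump b x).prod).sum

variable [MeasurableSpace X]

/-- The ideal measures: finite rational convex combinations of Dirac measures at ideal points. The
entry `(w, i)` puts a mass proportional to `w + 1` on the `i`-th ideal point. -/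
def idealMeasure (l : (ℕ × ℕ) × List (ℕ × ℕ)) : Measure X :=
  (((l.1 :: l.2).map fun t => ((t.1 : ℝ≥0∞) + 1)).sum)⁻¹ •
    ((l.1 :: l.2).map fun t =>
      ((t.1 : ℝ≥0∞) + 1) • Measure.dirac (ComputableMetricSpace.ideal t.2 : X)).sum

end Space

section Measures

variable {X : Type*} [MetricSpace X] [MeasurableSpace X]

/-- The Wasserstein-Kantorovich distance, as a supremum over 1-Lipschitz test functions. Test
functions are taken bounded, so that all integrals exist; on a bounded space this is no
restriction, and in general it does not change the supremum. -/
def W₁ (μ ν : Measure X) : ℝ≥0∞ :=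
  ⨆ (f : X → ℝ) (_ : LipschitzWith 1 f) (_ : ∃ C : ℝ, ∀ x, |f x| ≤ C),
    ENNReal.ofReal |∫ x, f x ∂μ - ∫ x, f x ∂ν|

/-- The `L¹(μ)`-distance between functions. -/
def distL1 (μ : Measure X) (f g : X → ℝ) : ℝ≥0∞ := eLpNorm (f - g) 1 μ

/-- `sup_{k ≥ n} |f_k - f|`, with values in `[0, ∞]`. -/
def tailSup (F : ℕ → X → ℝ) (f : X → ℝ) (n : ℕ) (x : X) : ℝ≥0∞ :=
  ⨆ (k : ℕ) (_ : n ≤ k), ENNReal.ofReal |F k x - f x|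

/-- `r(ε, δ)` is a rate of almost sure convergence of `F_n` to `f`: for all `n ≥ r(ε, δ)`,
`μ {sup_{k ≥ n} |F_k - f| ≥ ε} < δ`. -/
def IsRateAS (μ : Measure X) (F : ℕ → X → ℝ) (f : X → ℝ) (r : PosRat → PosRat → ℕ) : Prop :=
  ∀ (ε δ : PosRat) (n : ℕ), r ε δ ≤ n →
    μ {x | ENNReal.ofReal ((ε : ℚ) : ℝ) ≤ tailSup F f n x} < ENNReal.ofReal ((δ : ℚ) : ℝ)

/-- The random variables `F_n` effectively converge almost surely to `f`: there is a computable
rate `r(ε, δ)` of almost sure convergence. -/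
def EffectivelyConvergesAS (μ : Measure X) (F : ℕ → X → ℝ) (f : X → ℝ) : Prop :=
  ∃ r : PosRat → PosRat → ℕ,
    (∃ c : Code, ∀ ε δ, r ε δ ∈ c.eval (encode (ε, δ))) ∧ IsRateAS μ F f r

variable [ComputableMetricSpace X]

/-- The programs `p` describe the measure `μ`. -/
def DescribesMeasure (p : Code × Code) (μ : Measure X) : Prop :=
  DescribesPoint idealMeasure W₁ p μ

/-- The programs `p` describe the class of `f` in `L¹(μ)`. -/
def DescribesL1 (μ : Measure X) (p : Code × Code) (f : X → ℝ) : Prop :=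
  DescribesPoint idealFun (distL1 μ) p f

/-- The programs `p = (g, t)` describe the almost everywhere computable map `T`: `g` enumerates an
effective `G_δ`-set `D` of measure one, and `t` enumerates, uniformly in the ideal ball `B`, an
open set that coincides with `T⁻¹(B)` on `D`. -/
def DescribesAEMap (μ : Measure X) (p : Code × Code) (T : X → X) : Prop :=
  μ (effectiveGδ p.1) = 1 ∧
    ∀ b : ℕ × PosRat,
      T ⁻¹' idealBall b ∩ effectiveGδ p.1 = effectiveOpen p.2 b ∩ effectiveGδ p.1

/-- `μ` is a computable measure. -/
def IsComputableMeasure (μ : Measure X) : Prop := ∃ p, DescribesMeasure p μ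

/-- `T` is almost everywhere computable. -/
def IsAEComputable (μ : Measure X) (T : X → X) : Prop := ∃ p, DescribesAEMap μ p T

/-- `f` is `L¹(μ)`-computable. -/
def IsL1Computable (μ : Measure X) (f : X → ℝ) : Prop :=
  Integrable f μ ∧ ∃ p, DescribesL1 μ p f

/-- `(X, μ, T)` is a computable ergodic system: `μ` is a computable Borel probability measure, and
`T` is an almost everywhere computable, measure preserving and ergodic map. -/
structure IsComputableErgodicSystem (μ : Measure X) (T : X → X) : Prop where
  isProbabilityMeasure : IsProbabilityMeasure μ
  computable_measure : IsComputableMeasure μ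
  computable_map : IsAEComputable μ T
  ergodic : Ergodic T μ

end Measures

end ComputableErgodic

end

/-!
The algorithm searches for a certificate. Being a certificate is a recursively enumerable property
(`isRE_isCertifiedRate`), every certificate yields a valid rate (`IsCertifiedRate.measure_lt`), and
certificates always exist (`exists_isCertifiedRate`); hence one program finds a rate from any
descriptions of the system and the function (`IsRE.exists_code`).

The certificates come from the following proof of almost sure convergence. Approximate `f` in `L¹`
by an ideal function `g`. If the average `A_p g` is close in `L¹` to a constant `I`, then
`w = (f - g) + (A_p g - I)` is small in `L¹`, so by the maximal ergodic inequality
(`measure_exists_lt_birkhoffAverage_le`) all averages of `w` are small outside a small set. The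
averages over `n` steps of `f - I` and of `w` differ by those of `g - A_p g`, which are
`O(p ‖g‖_∞ / n)`. This gives an explicit rate in terms of `p` and a bound for `g`
(`measure_le_tailSup_le`).

What has to be found effectively is a number `p` for which `A_p g` is close in `L¹` to a constant.
For bounded functions it suffices to have closeness to a constant on a set of almost full measure.
Near a point of such a set, closeness is certified by a chain of `p` small ideal balls, each mapped
into the next one on the domain of computability of `T`, together with approximate values of `g` on
these balls. That the certified neighbourhoods have almost full measure is certified by an ideal
measure `ν` close to `μ`: most of the mass of `ν` sits at points around which, with some margin
`κ`, a chain is known, and `μ` gives nearly as much mass to the `κ`-neighbourhood of these points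
(`measureReal_le_thickening_add`). Nothing has to be known about the speed of convergence of
`A_p g`: the mean ergodic theorem (`tendstoInMeasure_birkhoffAverage`) ensures that the search for
`p` ends.

In the certificates rational numbers are represented by their codes or by unreduced fractions of
natural numbers, so that only the arithmetic of natural numbers has to be primitive recursive.
-/

namespace ComputableErgodic

/-! ### Recursively enumerable relations -/

section Enumerable

variable {α β γ : Type} [Primcodable α] [Primcodable β] [Primcodable γ]

attribute [fun_prop] Primrec Primrec.id Primrec.const Primrec.comp

@[fun_prop]
theorem primrec_fst {f : α → β × γ} (hf : Primrec f) : Primrec fun a => (f a).1 :=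
  Primrec.fst.comp hf

@[fun_prop]
theorem primrec_snd {f : α → β × γ} (hf : Primrec f) : Primrec fun a => (f a).2 :=
  Primrec.snd.comp hf

@[fun_prop]
theorem primrec_mk {f : α → β} {g : α → γ} (hf : Primrec f) (hg : Primrec g) :
    Primrec fun a => (f a, g a) := hf.pair hg

@[fun_prop]
theorem primrec_add {f g : α → ℕ} (hf : Primrec f) (hg : Primrec g) :
    Primrec fun a => f a + g a := Primrec.nat_add.comp hf hg

@[fun_prop]
theorem primrec_mul {f g : α → ℕ} (hf : Primrec f) (hg : Primrec g) :
    Primrec fun a => f a * g a := Primrec.nat_mul.comp hf hg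

@[fun_prop]
theorem primrec_sub {f g : α → ℕ} (hf : Primrec f) (hg : Primrec g) :
    Primrec fun a => f a - g a := Primrec.nat_sub.comp hf hg

@[fun_prop]
theorem primrec_div {f g : α → ℕ} (hf : Primrec f) (hg : Primrec g) :
    Primrec fun a => f a / g a := Primrec.nat_div.comp hf hg

@[fun_prop]
theorem primrec_mod {f g : α → ℕ} (hf : Primrec f) (hg : Primrec g) :
    Primrec fun a => f a % g a := Primrec.nat_mod.comp hf hg

@[fun_prop]
theorem primrec_natPair {f g : α → ℕ} (hf : Primrec f) (hg : Primrec g) :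
    Primrec fun a => Nat.pair (f a) (g a) := Primrec₂.natPair.comp hf hg

@[fun_prop]
theorem primrec_unpair {f : α → ℕ} (hf : Primrec f) :
    Primrec fun a => Nat.unpair (f a) := Primrec.unpair.comp hf

@[fun_prop]
theorem primrec_encode {f : α → β} (hf : Primrec f) :
    Primrec fun a => encode (f a) := Primrec.encode.comp hf

@[fun_prop]
theorem primrec_cons {f : α → β} {g : α → List β} (hf : Primrec f) (hg : Primrec g) :
    Primrec fun a => f a :: g a := Primrec.list_cons.comp hf hg

@[fun_prop]
theorem primrec_getD {f : α → List β} {g : α → ℕ} (d : β) (hf : Primrec f) (hg : Primrec g) :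
    Primrec fun a => (f a).getD (g a) d := (Primrec.list_getD d).comp hf hg

@[fun_prop]
theorem primrec_map {f : α → List β} {g : α → β → γ} (hf : Primrec f)
    (hg : Primrec fun x : α × β => g x.1 x.2) :
    Primrec fun a => (f a).map (g a) := Primrec.list_map hf hg

@[fun_prop]
theorem primrec_length {f : α → List β} (hf : Primrec f) :
    Primrec fun a => (f a).length := Primrec.list_length.comp hf

@[fun_prop]
theorem primrec_range {f : α → ℕ} (hf : Primrec f) :
    Primrec fun a => List.range (f a) := Primrec.list_range.comp hf

@[fun_prop]
theorem primrec_foldr {f : α → List β} {g : α → γ} {h : α → β → γ → γ} (hf : Primrec f)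
    (hg : Primrec g) (hh : Primrec fun x : α × β × γ => h x.1 x.2.1 x.2.2) :
    Primrec fun a => (f a).foldr (h a) (g a) :=
  Primrec.list_foldr (h := fun a x => h a x.1 x.2) hf hg hh

@[fun_prop]
theorem primrec_sum {f : α → List ℕ} (hf : Primrec f) : Primrec fun a => (f a).sum := by
  unfold List.sum
  fun_prop

@[fun_prop]
theorem primrec_prod {f : α → List ℕ} (hf : Primrec f) : Primrec fun a => (f a).prod := by
  unfold List.prod
  fun_prop

theorem primrecPred_le {f g : α → ℕ} (hf : Primrec f) (hg : Primrec g) :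
    PrimrecPred fun a => f a ≤ g a := Primrec.nat_le.comp hf hg

theorem primrecPred_lt {f g : α → ℕ} (hf : Primrec f) (hg : Primrec g) :
    PrimrecPred fun a => f a < g a := Primrec.nat_lt.comp hf hg

theorem primrecPred_eq {f g : α → β} (hf : Primrec f) (hg : Primrec g) :
    PrimrecPred fun a => f a = g a := Primrec.eq.comp hf hg

/-- A predicate is recursively enumerable. It is presented as a growing union, over stages `k`, of
predicates `q · k` that are primitive recursive jointly in the argument and the stage. -/
def IsRE (p : α → Prop) : Prop :=
  ∃ q : α → ℕ → Prop, PrimrecRel q ∧ (∀ a, Monotone (q a)) ∧ ∀ a, p a ↔ ∃ k, q a k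

theorem IsRE.of_exists_nat {p : α → Prop} {q : α → ℕ → Prop} (hq : PrimrecRel q)
    (h : ∀ a, p a ↔ ∃ k, q a k) : IsRE p := by
  refine ⟨fun a k => ∃ i < k, q a i, ?_, ?_, ?_⟩
  · have hR : PrimrecRel fun (i : ℕ) (a : α) => q a i := hq.swap
    refine (hR.exists_mem_list.comp (f := fun x : α × ℕ => List.range x.2)
      (g := fun x : α × ℕ => x.1) (by fun_prop) (by fun_prop)).of_eq fun x => ?_
    simp
  · rintro a k k' hk ⟨i, hi, h⟩
    exact ⟨i, hi.trans_le hk, h⟩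
  · intro a
    rw [h]
    exact ⟨fun ⟨k, hk⟩ => ⟨k + 1, k, k.lt_succ_self, hk⟩, fun ⟨_, i, _, hi⟩ => ⟨i, hi⟩⟩

theorem IsRE.of_primrecPred {p : α → Prop} (hp : PrimrecPred p) : IsRE p :=
  ⟨fun a _ => p a, hp.comp Primrec.fst, fun _ _ _ _ h => h, fun _ => ⟨fun h => ⟨0, h⟩,
    fun ⟨_, h⟩ => h⟩⟩

theorem IsRE.comp {p : β → Prop} (hp : IsRE p) {f : α → β} (hf : Primrec f) :
    IsRE fun a => p (f a) := by
  obtain ⟨q, h1, h2, h3⟩ := hp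
  exact ⟨fun a k => q (f a) k, h1.comp (hf.comp Primrec.fst) Primrec.snd, fun a => h2 _,
    fun a => h3 _⟩

theorem IsRE.and {p q : α → Prop} (hp : IsRE p) (hq : IsRE q) : IsRE fun a => p a ∧ q a := by
  obtain ⟨p', h1, h2, h3⟩ := hp
  obtain ⟨q', g1, g2, g3⟩ := hq
  refine ⟨fun a k => p' a k ∧ q' a k, PrimrecPred.and h1 g1,
    fun a i j hij h => ⟨h2 a hij h.1, g2 a hij h.2⟩, fun a => ?_⟩
  beta_reduce
  rw [h3, g3]
  constructor
  · rintro ⟨⟨i, hi⟩, j, hj⟩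
    exact ⟨max i j, h2 a (le_max_left i j) hi, g2 a (le_max_right i j) hj⟩
  · rintro ⟨k, h, h'⟩
    exact ⟨⟨k, h⟩, k, h'⟩

theorem IsRE.exists {p : α → β → Prop} (hp : IsRE fun x : α × β => p x.1 x.2) :
    IsRE fun a => ∃ b, p a b := by
  obtain ⟨q, h1, h2, h3⟩ := hp
  classical
  have h1' : PrimrecPred fun x : (α × ℕ) × β => q (x.1.1, x.2) x.1.2.unpair.2 :=
    h1.comp (by fun_prop) (by fun_prop)
  have hP : PrimrecRel fun (a : α) (k : ℕ) =>
      ∃ b, decode (α := β) k.unpair.1 = some b ∧ q (a, b) k.unpair.2 := by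
    have : Primrec fun x : α × ℕ => (decode (α := β) x.2.unpair.1).elim false
        fun b => decide (q (x.1, b) x.2.unpair.2) := by
      refine (Primrec.option_casesOn (o := fun x : α × ℕ => decode (α := β) x.2.unpair.1)
        (f := fun _ => false) (g := fun x b => decide (q (x.1, b) x.2.unpair.2)) ?_ ?_ ?_).of_eq ?_
      · exact Primrec.decode.comp (by fun_prop)
      · fun_prop
      · exact h1'.decide
      · intro x
        cases decode (α := β) x.2.unpair.1 <;> rfl
    refine PrimrecPred.of_eq (p := fun x : α × ℕ => ((decode (α := β) x.2.unpair.1).elim false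
        fun b => decide (q (x.1, b) x.2.unpair.2)) = true) (primrecPred_eq this (by fun_prop)) ?_
    intro x
    beta_reduce
    generalize decode (α := β) x.2.unpair.1 = o
    cases o <;> simp
  refine IsRE.of_exists_nat hP fun a => ?_
  constructor
  · rintro ⟨b, hb⟩
    obtain ⟨k, hk⟩ := (h3 (a, b)).1 hb
    exact ⟨Nat.pair (encode b) k, b, by simp, by simpa using hk⟩
  · rintro ⟨k, b, _, hb⟩
    exact ⟨b, (h3 (a, b)).2 ⟨_, hb⟩⟩

theorem IsRE.forall_mem {p : α → β → Prop} (hp : IsRE fun x : α × β => p x.1 x.2)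
    {l : α → List β} (hl : Primrec l) : IsRE fun a => ∀ b ∈ l a, p a b := by
  obtain ⟨q, h1, h2, h3⟩ := hp
  have hR : PrimrecRel fun (b : β) (x : α × ℕ) => q (x.1, b) x.2 :=
    h1.comp (f := fun y : β × α × ℕ => (y.2.1, y.1)) (by fun_prop) (by fun_prop)
  refine ⟨fun a k => ∀ b ∈ l a, q (a, b) k,
    hR.forall_mem_list.comp (f := fun x : α × ℕ => l x.1) (by fun_prop) Primrec.id,
    fun a i j hij h b hb => h2 _ hij (h b hb), fun a => ?_⟩
  constructor
  · intro h
    have h' : ∀ b, ∃ k, b ∈ l a → q (a, b) k := fun b => by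
      by_cases hb : b ∈ l a
      · obtain ⟨k, hk⟩ := (h3 (a, b)).1 (h b hb)
        exact ⟨k, fun _ => hk⟩
      · exact ⟨0, fun h => absurd h hb⟩
    choose K hK using h'
    -- any upper bound for the finitely many stages serves, for instance their sum
    refine ⟨((l a).map K).sum, fun b hb => h2 _ ?_ (hK b hb)⟩
    exact List.single_le_sum (by simp) _ (List.mem_map_of_mem hb)
  · rintro ⟨k, hk⟩ b hb
    exact (h3 (a, b)).2 ⟨k, hk b hb⟩

theorem IsRE.eval {c : α → Code} {f g : α → ℕ} (hc : Primrec c) (hf : Primrec f)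
    (hg : Primrec g) : IsRE fun a => g a ∈ (c a).eval (f a) := by
  refine IsRE.of_exists_nat (q := fun a k => Code.evaln k (c a) (f a) = some (g a)) ?_ ?_
  · refine primrecPred_eq (α := α × ℕ) ?_ ?_
    · exact Code.primrec_evaln.comp (g := fun x : α × ℕ => ((x.2, c x.1), f x.1)) (by fun_prop)
    · exact Primrec.option_some.comp (by fun_prop)
  · exact fun a => Code.evaln_complete

/-- Uniformization: one algorithm finds, for every `a` that admits an `n` related to it by a
recursively enumerable relation, such an `n`. -/
theorem IsRE.exists_code {p : α → ℕ → Prop} (hp : IsRE fun x : α × ℕ => p x.1 x.2) :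
    ∃ N : Code, ∀ a, (∃ n, p a n) → ∃ n ∈ N.eval (encode a), p a n := by
  obtain ⟨q, h1, h2, h3⟩ := hp
  classical
  have hd : Primrec₂ fun (a : α) (k : ℕ) => decide (q (a, k.unpair.1) k.unpair.2) :=
    (h1.comp (f := fun x : α × ℕ => (x.1, x.2.unpair.1)) (g := fun x : α × ℕ => x.2.unpair.2)
      (by fun_prop) (by fun_prop)).decide
  -- search for a pair of a candidate and a stage at which it is confirmed
  have hF : Partrec fun a : α =>
      (Nat.rfind fun k => Part.some (decide (q (a, k.unpair.1) k.unpair.2))).map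
        fun k => k.unpair.1 := by
    refine Partrec.map (Partrec.rfind hd.to_comp.partrec₂) ?_
    exact (Primrec.fst.comp (Primrec.unpair.comp Primrec.snd)).to_comp
  have hN := hF
  unfold Partrec at hN
  obtain ⟨N, hN⟩ := Code.exists_code.1 hN
  refine ⟨N, fun a ⟨n, hn⟩ => ?_⟩
  obtain ⟨k, hk⟩ := (h3 (a, n)).1 hn
  have hdom : (Nat.rfind fun k => Part.some (decide (q (a, k.unpair.1) k.unpair.2))).Dom := by
    refine Nat.rfind_dom.2 ?_
    exact ⟨Nat.pair n k, by simpa using hk, fun _ => trivial⟩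
  obtain ⟨j, hj⟩ := Part.dom_iff_mem.1 hdom
  refine ⟨j.unpair.1, ?_, ?_⟩
  · rw [hN]
    simp only [encodek, Part.coe_some, Part.bind_some, Part.mem_map_iff, encode_nat]
    exact ⟨_, ⟨j, hj, rfl⟩, rfl⟩
  · have := Nat.rfind_spec hj
    simp only [Part.mem_some_iff] at this
    exact (h3 (a, _)).2 ⟨_, of_decide_eq_true this.symm⟩

end Enumerable

/-! ### Certificates for a rate of convergence -/

/-- The numerator of the rational number with code `n` if it is positive, and `0` otherwise. -/
def posNum (n : ℕ) : ℕ := (1 - n.unpair.1 % 2) * (n.unpair.1 / 2)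

/-- The absolute value of the numerator of the rational number with code `n` if the numerator is
negative, and `0` otherwise. -/
def negNum (n : ℕ) : ℕ := n.unpair.1 % 2 * (n.unpair.1 / 2 + 1)

/-- The denominator of the rational number with code `n`. -/
def denom (n : ℕ) : ℕ := n.unpair.2

/-- The code of the rational number `1 / (m + 1)`. -/
def unitCode (m : ℕ) : ℕ := Nat.pair 2 (m + 1)

/-- Signed fractions: `(a, b, c)` stands for `(a - b) / c`. They need not be reduced. -/
abbrev SignedFrac : Type := ℕ × ℕ × ℕ

/-- The sum of two signed fractions. -/
def SignedFrac.add (x y : SignedFrac) : SignedFrac :=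
  (x.1 * y.2.2 + y.1 * x.2.2, x.2.1 * y.2.2 + y.2.1 * x.2.2, x.2.2 * y.2.2)

/-- The sum of a list of signed fractions. -/
def SignedFrac.sum (l : List SignedFrac) : SignedFrac := l.foldr SignedFrac.add (0, 0, 1)

/-- The ideal functions of `idealFun`, with rational numbers replaced by their codes. -/
abbrev FunCode : Type := List (ℕ × List (ℕ × ℕ × ℕ))

/-- A denominator for the value of the bump function with number `b` at a point at distance `d`
from its centre, where the rational `d` has code `q`. -/
def bumpDen (b : ℕ × ℕ × ℕ) (q : ℕ) : ℕ := denom q * denom b.2.1 * posNum b.2.2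

/-- The numerator that goes with `bumpDen`; the truncated subtractions compute the maxima with zero
in the definition of the bump function. -/
def bumpNum (b : ℕ × ℕ × ℕ) (q : ℕ) : ℕ :=
  bumpDen b q - (posNum q * denom b.2.1 - posNum b.2.1 * denom q) * denom b.2.2

/-- The value of an ideal function at a point, where each bump function `b` comes with the code `q`
of the distance of the point from the centre of `b`. -/
def evalCode (L : List (ℕ × List ((ℕ × ℕ × ℕ) × ℕ))) : SignedFrac :=
  SignedFrac.sum (L.map fun t =>
    (posNum t.1 * (t.2.map fun b => bumpNum b.1 b.2).prod,
      negNum t.1 * (t.2.map fun b => bumpNum b.1 b.2).prod,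
      denom t.1 * (t.2.map fun b => bumpDen b.1 b.2).prod))

/-- A natural number that bounds both the supremum norm and the Lipschitz constant of the ideal
function with code `l`. -/
def funBound (l : FunCode) : ℕ :=
  (l.map fun t => (posNum t.1 + negNum t.1) * (1 + (t.2.map fun b => denom b.2.2).sum)).sum

/-- A ball of radius `1 / (m + 1)` around the `j`-th ideal point together with a signed fraction `v`
that approximates a given function on this ball, as the triple `(j, m, v)`. -/
abbrev MarkedBall : Type := ℕ × ℕ × SignedFrac

/-- `v` is the value of the ideal function with code `l` computed from `2 ^ (-n)`-approximations,
supplied by `cd`, to the distances of the `j`-th ideal point from the centres of the bumps. -/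
def Evaluates (cd : Code) (l : FunCode) (j n : ℕ) (v : SignedFrac) : Prop :=
  ∃ L : List (ℕ × List ((ℕ × ℕ × ℕ) × ℕ)),
    L.map (fun t => (t.1, t.2.map Prod.fst)) = l ∧
    (∀ t ∈ L, ∀ b ∈ t.2, b.2 ∈ cd.eval (encode (b.1.1, j, n))) ∧ v = evalCode L

/-- The program `cd` for the distances witnesses that `d(s_i, s_j) + r < r'`, where `q` and `q'` are
the codes of the positive rational numbers `r` and `r'`. In particular `B(s_i, r) ⊆ B(s_j, r')`. -/
def Inside (cd : Code) (i j q q' : ℕ) : Prop :=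
  ∃ n d : ℕ, d ∈ cd.eval (encode (i, j, n)) ∧
    (posNum d * (n + 1) * denom q + denom d * denom q + posNum q * denom d * (n + 1)) * denom q' <
      posNum q' * denom d * (n + 1) * denom q

/-- The mark of the ball `c` is computed precisely enough to be within `1 / S` of the ideal function
with code `l` on the whole ball. -/
def WellMarked (cd : Code) (l : FunCode) (S : ℕ) (c : MarkedBall) : Prop :=
  ∃ n, Evaluates cd l c.1 n c.2.2 ∧ funBound l * (2 * S) ≤ n + 1 ∧
    funBound l * (2 * S) ≤ c.2.1 + 1

/-- The number `q` is the code of a positive rational number. Bézout's identity expresses that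
numerator and denominator are coprime. A program that enumerates an open set may also output numbers
that are not codes of balls, and these have to be ignored. -/
def IsPosCode (q : ℕ) : Prop :=
  (0 < posNum q ∧ 0 < denom q) ∧ ∃ u v, posNum q * u = denom q * v + 1

/-- The ball `c` lies inside one of the ideal balls that the program `t` enumerates for the preimage
of the ball `c'`. -/
def MapsInto (cd t : Code) (c c' : MarkedBall) : Prop :=
  ∃ n j q : ℕ, encode (j, q) ∈ t.eval (encode ((c'.1, unitCode c'.2.1), n)) ∧
    IsPosCode q ∧ Inside cd c.1 j (unitCode c.2.1) q

/-- The balls of `C` are well marked, and each of them is mapped into the next one. -/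
def IsOrbitChain (cd t : Code) (l : FunCode) (S : ℕ) (C : List MarkedBall) : Prop :=
  (∀ c ∈ C, WellMarked cd l S c) ∧
    ∀ k ∈ List.range (C.length - 1), MapsInto cd t (C.getD k default) (C.getD (k + 1) default)

/-- The mean of the marks of `C` is within `3 / S` of `(I.1 - I.2) / S`. -/
def MeanNear (S : ℕ) (I : ℕ × ℕ) (C : List MarkedBall) : Prop :=
  (SignedFrac.sum (C.map fun c => c.2.2)).1 * S +
      C.length * I.2 * (SignedFrac.sum (C.map fun c => c.2.2)).2.2 ≤
    C.length * (I.1 + 3) * (SignedFrac.sum (C.map fun c => c.2.2)).2.2 +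
      (SignedFrac.sum (C.map fun c => c.2.2)).2.1 * S ∧
  (SignedFrac.sum (C.map fun c => c.2.2)).2.1 * S +
      C.length * I.1 * (SignedFrac.sum (C.map fun c => c.2.2)).2.2 ≤
    C.length * (I.2 + 3) * (SignedFrac.sum (C.map fun c => c.2.2)).2.2 +
      (SignedFrac.sum (C.map fun c => c.2.2)).1 * S

/-- A chain of `p` balls starting around `B(s_i, 1 / (m + 1))` shows that there the Birkhoff
averages over `p` steps are close to `(I.1 - I.2) / S`. -/
def GoodPoint (cd t : Code) (l : FunCode) (S p : ℕ) (I : ℕ × ℕ) (m i : ℕ) : Prop :=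
  ∃ C : List MarkedBall, C.length = p ∧ IsOrbitChain cd t l S C ∧ MeanNear S I C ∧
    Inside cd i (C.getD 0 default).1 (unitCode m) (unitCode (C.getD 0 default).2.1)

/-- The total weight in the ideal measure with number `A`. -/
def totalWeight (A : (ℕ × ℕ) × List (ℕ × ℕ)) : ℕ := ((A.1 :: A.2).map fun t => t.1 + 1).sum

/-- The weight of the atoms with index outside `G` in the ideal measure with number `A`. -/
def weightOutside (G : List ℕ) (A : (ℕ × ℕ) × List (ℕ × ℕ)) : ℕ :=
  ((A.1 :: A.2).map fun t => if t.2 ∈ G then 0 else t.1 + 1).sum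

/-- The point described by the programs `c` is within `1 / (m + 1)` of the ideal point with
number `a`. -/
def Approximates (c : Code × Code) (m a : ℕ) : Prop :=
  ∃ k, k ∈ c.2.eval (unitCode m) ∧ a ∈ c.1.eval k

/-- The certificates: up to measure `1 / θ`, the Birkhoff averages over `p` steps of the ideal
function with code `l` are within `4 / S` of the constant `(I.1 - I.2) / S`. Half of the measure
`1 / θ` is allowed for the atoms of an ideal measure that are not known to be good; the other half
pays for replacing `μ` by the ideal measure, which costs their distance divided by the margin
`1 / (m + 1)`. -/
def MostlyNear (cd t : Code) (pμ : Code × Code) (l : FunCode) (S θ p : ℕ) (I : ℕ × ℕ) : Prop :=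
  ∃ (m : ℕ) (A : (ℕ × ℕ) × List (ℕ × ℕ)) (G : List ℕ),
    Approximates pμ (4 * θ * (m + 1)) (encode A) ∧ (∀ i ∈ G, GoodPoint cd t l S p I m i) ∧
      weightOutside G A * (2 * θ) ≤ totalWeight A

/-- Programs for the map, the measure and the function, and the codes of `ε` and `δ`. -/
abbrev RateInput : Type := ((Code × Code) × (Code × Code) × (Code × Code)) × ℕ × ℕ

/-- Eight times the product of the denominators of `ε` and `δ`. -/
def RateInput.scale (x : RateInput) : ℕ := 8 * denom x.2.1 * denom x.2.2

/-- The search problem solved by the algorithm: `N` is a rate at `(ε, δ)` because of an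
approximation `l` to the function in `L¹`, a number `p` of steps and a certificate that averaging
`l` over `p` steps yields a function with small distance to a constant in `L¹`. -/
def IsCertifiedRate (cd : Code) (x : RateInput) (N : ℕ) : Prop :=
  ∃ (l : FunCode) (p : ℕ) (I : ℕ × ℕ), Approximates x.1.2.2 (2 * x.scale) (encode l) ∧
    MostlyNear cd x.1.1.2 x.1.2.1 l (16 * x.scale) (4 * x.scale * (2 * funBound l + 1)) (p + 1) I ∧
    N = 8 * denom x.2.1 * (p + 1) * funBound l + 1

section Primrec

variable {α : Type} [Primcodable α]

@[fun_prop]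
theorem primrec_posNum {f : α → ℕ} (hf : Primrec f) : Primrec fun a => posNum (f a) := by
  unfold posNum; fun_prop

@[fun_prop]
theorem primrec_negNum {f : α → ℕ} (hf : Primrec f) : Primrec fun a => negNum (f a) := by
  unfold negNum; fun_prop

@[fun_prop]
theorem primrec_denom {f : α → ℕ} (hf : Primrec f) : Primrec fun a => denom (f a) := by
  unfold denom; fun_prop

@[fun_prop]
theorem primrec_unitCode {f : α → ℕ} (hf : Primrec f) : Primrec fun a => unitCode (f a) := by
  unfold unitCode; fun_prop

@[fun_prop]
theorem primrec_signedFrac_add {f g : α → SignedFrac} (hf : Primrec f) (hg : Primrec g) :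
    Primrec fun a => (f a).add (g a) := by
  unfold SignedFrac.add; fun_prop

@[fun_prop]
theorem primrec_signedFrac_sum {f : α → List SignedFrac} (hf : Primrec f) :
    Primrec fun a => SignedFrac.sum (f a) := by
  unfold SignedFrac.sum; fun_prop

@[fun_prop]
theorem primrec_bumpDen {f : α → ℕ × ℕ × ℕ} {g : α → ℕ} (hf : Primrec f) (hg : Primrec g) :
    Primrec fun a => bumpDen (f a) (g a) := by
  unfold bumpDen; fun_prop

@[fun_prop]
theorem primrec_bumpNum {f : α → ℕ × ℕ × ℕ} {g : α → ℕ} (hf : Primrec f) (hg : Primrec g) :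
    Primrec fun a => bumpNum (f a) (g a) := by
  unfold bumpNum; fun_prop

@[fun_prop]
theorem primrec_evalCode {f : α → List (ℕ × List ((ℕ × ℕ × ℕ) × ℕ))} (hf : Primrec f) :
    Primrec fun a => evalCode (f a) := by
  unfold evalCode; fun_prop

@[fun_prop]
theorem primrec_funBound {f : α → FunCode} (hf : Primrec f) :
    Primrec fun a => funBound (f a) := by
  unfold funBound; fun_prop

@[fun_prop]
theorem primrec_totalWeight {f : α → (ℕ × ℕ) × List (ℕ × ℕ)} (hf : Primrec f) :
    Primrec fun a => totalWeight (f a) := by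
  unfold totalWeight; fun_prop

theorem primrecPred_mem {f : α → ℕ} {g : α → List ℕ} (hf : Primrec f) (hg : Primrec g) :
    PrimrecPred fun a => f a ∈ g a := by
  have h : PrimrecRel fun (L : List ℕ) (b : ℕ) => ∃ a ∈ L, a = b := Primrec.eq.exists_mem_list
  exact (h.comp hg hf).of_eq fun a => by simp

@[fun_prop]
theorem primrec_weightOutside {f : α → List ℕ} {g : α → (ℕ × ℕ) × List (ℕ × ℕ)} (hf : Primrec f)
    (hg : Primrec g) : Primrec fun a => weightOutside (f a) (g a) := by
  unfold weightOutside
  refine primrec_sum (primrec_map (by fun_prop) ?_)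
  exact Primrec.ite (primrecPred_mem (by fun_prop) (by fun_prop)) (by fun_prop) (by fun_prop)

@[fun_prop]
theorem primrec_scale {f : α → RateInput} (hf : Primrec f) : Primrec fun a => (f a).scale := by
  unfold RateInput.scale; fun_prop

end Primrec

section Enumerable

variable {α : Type} [Primcodable α]

theorem isRE_evaluates (cd : Code) {l : α → FunCode} {j n : α → ℕ} {v : α → SignedFrac}
    (hl : Primrec l) (hj : Primrec j) (hn : Primrec n) (hv : Primrec v) :
    IsRE fun a => Evaluates cd (l a) (j a) (n a) (v a) := by
  refine IsRE.exists (IsRE.and (IsRE.of_primrecPred (primrecPred_eq (by fun_prop) (by fun_prop)))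
    (IsRE.and ?_ (IsRE.of_primrecPred (primrecPred_eq (by fun_prop) (by fun_prop)))))
  refine IsRE.forall_mem (IsRE.forall_mem ?_ (by fun_prop)) (by fun_prop)
  exact IsRE.eval (by fun_prop) (by fun_prop) (by fun_prop)

theorem isRE_inside (cd : Code) {i j q q' : α → ℕ} (hi : Primrec i) (hj : Primrec j)
    (hq : Primrec q) (hq' : Primrec q') : IsRE fun a => Inside cd (i a) (j a) (q a) (q' a) := by
  refine IsRE.exists (IsRE.exists (IsRE.and ?_ (IsRE.of_primrecPred
    (primrecPred_lt (by fun_prop) (by fun_prop)))))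
  exact IsRE.eval (by fun_prop) (by fun_prop) (by fun_prop)

theorem isRE_wellMarked (cd : Code) {l : α → FunCode} {S : α → ℕ} {c : α → MarkedBall}
    (hl : Primrec l) (hS : Primrec S) (hc : Primrec c) :
    IsRE fun a => WellMarked cd (l a) (S a) (c a) := by
  refine IsRE.exists (IsRE.and ?_ (IsRE.of_primrecPred
    (PrimrecPred.and (primrecPred_le ?_ ?_) (primrecPred_le ?_ ?_))))
  · exact isRE_evaluates cd (by fun_prop) (by fun_prop) (by fun_prop) (by fun_prop)
  all_goals fun_prop

theorem isRE_isPosCode {q : α → ℕ} (hq : Primrec q) : IsRE fun a => IsPosCode (q a) := by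
  refine IsRE.and (IsRE.of_primrecPred (PrimrecPred.and (primrecPred_lt ?_ ?_)
    (primrecPred_lt ?_ ?_))) (IsRE.exists (IsRE.exists (IsRE.of_primrecPred
      (primrecPred_eq ?_ ?_))))
  all_goals fun_prop

theorem isRE_mapsInto (cd : Code) {t : α → Code} {c c' : α → MarkedBall}
    (ht : Primrec t) (hc : Primrec c) (hc' : Primrec c') :
    IsRE fun a => MapsInto cd (t a) (c a) (c' a) := by
  refine IsRE.exists (IsRE.exists (IsRE.exists (IsRE.and ?_ (IsRE.and ?_ ?_))))
  · exact IsRE.eval (by fun_prop) (by fun_prop) (by fun_prop)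
  · exact isRE_isPosCode (by fun_prop)
  · exact isRE_inside cd (by fun_prop) (by fun_prop) (by fun_prop) (by fun_prop)

theorem isRE_isOrbitChain (cd : Code) {t : α → Code} {l : α → FunCode} {S : α → ℕ}
    {C : α → List MarkedBall} (ht : Primrec t) (hl : Primrec l) (hS : Primrec S)
    (hC : Primrec C) : IsRE fun a => IsOrbitChain cd (t a) (l a) (S a) (C a) := by
  refine IsRE.and (IsRE.forall_mem ?_ hC) (IsRE.forall_mem ?_ ?_)
  · exact isRE_wellMarked cd (by fun_prop) (by fun_prop) (by fun_prop)
  · exact isRE_mapsInto cd (by fun_prop) (by fun_prop) (by fun_prop)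
  · fun_prop

theorem primrecPred_meanNear {S : α → ℕ} {I : α → ℕ × ℕ} {C : α → List MarkedBall}
    (hS : Primrec S) (hI : Primrec I) (hC : Primrec C) :
    PrimrecPred fun a => MeanNear (S a) (I a) (C a) := by
  refine PrimrecPred.and (primrecPred_le ?_ ?_) (primrecPred_le ?_ ?_)
  all_goals fun_prop

theorem isRE_goodPoint (cd : Code) {t : α → Code} {l : α → FunCode} {S p : α → ℕ}
    {I : α → ℕ × ℕ} {m i : α → ℕ} (ht : Primrec t) (hl : Primrec l) (hS : Primrec S)
    (hp : Primrec p) (hI : Primrec I) (hm : Primrec m) (hi : Primrec i) :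
    IsRE fun a => GoodPoint cd (t a) (l a) (S a) (p a) (I a) (m a) (i a) := by
  refine IsRE.exists (IsRE.and ?_ (IsRE.and ?_ (IsRE.and ?_ ?_)))
  · exact IsRE.of_primrecPred (primrecPred_eq (by fun_prop) (by fun_prop))
  · exact isRE_isOrbitChain cd (by fun_prop) (by fun_prop) (by fun_prop) (by fun_prop)
  · exact IsRE.of_primrecPred (primrecPred_meanNear (by fun_prop) (by fun_prop) (by fun_prop))
  · exact isRE_inside cd (by fun_prop) (by fun_prop) (by fun_prop) (by fun_prop)

theorem isRE_approximates {c : α → Code × Code} {m a : α → ℕ} (hc : Primrec c)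
    (hm : Primrec m) (ha : Primrec a) : IsRE fun x => Approximates (c x) (m x) (a x) :=
  IsRE.exists (IsRE.and (IsRE.eval (by fun_prop) (by fun_prop) (by fun_prop))
    (IsRE.eval (by fun_prop) (by fun_prop) (by fun_prop)))

theorem isRE_mostlyNear (cd : Code) {t : α → Code} {pμ : α → Code × Code} {l : α → FunCode}
    {S θ p : α → ℕ} {I : α → ℕ × ℕ} (ht : Primrec t) (hpμ : Primrec pμ) (hl : Primrec l)
    (hS : Primrec S) (hθ : Primrec θ) (hp : Primrec p) (hI : Primrec I) :
    IsRE fun a => MostlyNear cd (t a) (pμ a) (l a) (S a) (θ a) (p a) (I a) := by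
  refine IsRE.exists (IsRE.exists (IsRE.exists (IsRE.and ?_ (IsRE.and ?_ ?_))))
  · exact isRE_approximates (by fun_prop) (by fun_prop) (by fun_prop)
  · refine IsRE.forall_mem ?_ (by fun_prop)
    exact isRE_goodPoint cd (by fun_prop) (by fun_prop) (by fun_prop) (by fun_prop) (by fun_prop)
      (by fun_prop) (by fun_prop)
  · exact IsRE.of_primrecPred (primrecPred_le (by fun_prop) (by fun_prop))

theorem isRE_isCertifiedRate (cd : Code) :
    IsRE fun x : RateInput × ℕ => IsCertifiedRate cd x.1 x.2 := by
  refine IsRE.exists (IsRE.exists (IsRE.exists (IsRE.and ?_ (IsRE.and ?_ ?_))))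
  · exact isRE_approximates (by fun_prop) (by fun_prop) (by fun_prop)
  · exact isRE_mostlyNear cd (by fun_prop) (by fun_prop) (by fun_prop) (by fun_prop) (by fun_prop)
      (by fun_prop) (by fun_prop)
  · exact IsRE.of_primrecPred (primrecPred_eq (by fun_prop) (by fun_prop))

end Enumerable

/-! ### Ergodic averages -/

section Ergodic

variable {Ω : Type*}

/-- The maximum of the Birkhoff sums of `h` over `0, …, n` steps. -/
def maxBirkhoffSum (T : Ω → Ω) (h : Ω → ℝ) : ℕ → Ω → ℝ
  | 0, _ => 0
  | n + 1, x => max 0 (h x + maxBirkhoffSum T h n (T x))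

theorem maxBirkhoffSum_nonneg (T : Ω → Ω) (h : Ω → ℝ) (n : ℕ) (x : Ω) :
    0 ≤ maxBirkhoffSum T h n x := by
  cases n
  · exact le_rfl
  · exact le_max_left _ _

theorem maxBirkhoffSum_le_succ (T : Ω → Ω) (h : Ω → ℝ) (n : ℕ) (x : Ω) :
    maxBirkhoffSum T h n x ≤ maxBirkhoffSum T h (n + 1) x := by
  induction n generalizing x with
  | zero => exact maxBirkhoffSum_nonneg T h 1 x
  | succ n ih => exact max_le_max le_rfl (add_le_add le_rfl (ih (T x)))

theorem birkhoffSum_le_maxBirkhoffSum (T : Ω → Ω) (h : Ω → ℝ) {k n : ℕ} (hk : k ≤ n) (x : Ω) :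
    birkhoffSum T h k x ≤ maxBirkhoffSum T h n x := by
  induction n generalizing k x with
  | zero =>
    obtain rfl : k = 0 := by omega
    exact le_rfl
  | succ n ih =>
    cases k with
    | zero => exact le_max_left _ _
    | succ k =>
      rw [birkhoffSum_succ']
      exact le_max_of_le_right (add_le_add le_rfl (ih (by omega) (T x)))

theorem birkhoffSum_sub_const (T : Ω → Ω) (h : Ω → ℝ) (c : ℝ) (k : ℕ) (x : Ω) :
    birkhoffSum T (fun x => h x - c) k x = birkhoffSum T h k x - k * c := by
  simp [birkhoffSum, Finset.sum_sub_distrib]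

variable [MeasurableSpace Ω] {μ : Measure Ω} {T : Ω → Ω}

theorem measurable_maxBirkhoffSum (hT : Measurable T) {h : Ω → ℝ} (hh : Measurable h) (n : ℕ) :
    Measurable (maxBirkhoffSum T h n) := by
  induction n with
  | zero => exact measurable_const
  | succ n ih => exact measurable_const.max (hh.add (ih.comp hT))

theorem integrable_maxBirkhoffSum [IsFiniteMeasure μ] (hT : MeasurePreserving T μ μ) {h : Ω → ℝ}
    (hh : Integrable h μ) (n : ℕ) : Integrable (maxBirkhoffSum T h n) μ := by
  induction n with
  | zero => exact integrable_zero Ω ℝ μ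
  | succ n ih =>
    exact (integrable_const (0 : ℝ)).sup (hh.add (hT.integrable_comp_of_integrable ih))

/-- Garsia's form of the maximal ergodic theorem. -/
theorem setIntegral_nonneg_of_maxBirkhoffSum_pos [IsFiniteMeasure μ]
    (hT : MeasurePreserving T μ μ) {h : Ω → ℝ} (hm : Measurable h) (hh : Integrable h μ) (n : ℕ) :
    0 ≤ ∫ x in {x | 0 < maxBirkhoffSum T h n x}, h x ∂μ := by
  cases n with
  | zero => simp [maxBirkhoffSum]
  | succ n =>
    set M := maxBirkhoffSum T h (n + 1)
    have hMi : Integrable M μ := integrable_maxBirkhoffSum hT hh _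
    have hE : MeasurableSet {x | 0 < M x} :=
      measurableSet_lt measurable_const (measurable_maxBirkhoffSum hT.measurable hm _)
    rw [← integral_indicator hE]
    have hMT : Integrable (fun x => M (T x)) μ := hT.integrable_comp_of_integrable hMi
    have h0 : ∫ x, (M x - M (T x)) ∂μ = 0 := by
      rw [integral_sub hMi hMT]
      have := integral_map (μ := μ) hT.measurable.aemeasurable (f := M)
        (by rw [hT.map_eq]; exact hMi.aestronglyMeasurable)
      rw [hT.map_eq] at this
      rw [← this, sub_self]
    refine h0.symm.le.trans (integral_mono (hMi.sub hMT) (hh.indicator hE) ?_)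
    intro x
    by_cases hx : 0 < M x
    · rw [indicator_of_mem (show x ∈ {x | 0 < M x} from hx)]
      have h1 : M x = max 0 (h x + maxBirkhoffSum T h n (T x)) := rfl
      have h2 : M x = h x + maxBirkhoffSum T h n (T x) := by
        rcases max_choice 0 (h x + maxBirkhoffSum T h n (T x)) with h3 | h3
        · rw [h1, h3] at hx
          exact absurd hx (lt_irrefl _)
        · rw [h1, h3]
      have h3 := maxBirkhoffSum_le_succ T h n (T x)
      have h4 : maxBirkhoffSum T h (n + 1) (T x) = M (T x) := rfl
      beta_reduce
      linarith
    · rw [indicator_of_notMem (show x ∉ {x | 0 < M x} from hx)]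
      have := maxBirkhoffSum_nonneg T h (n + 1) (T x)
      have h4 : maxBirkhoffSum T h (n + 1) (T x) = M (T x) := rfl
      beta_reduce
      linarith [not_lt.1 hx]

/-- The maximal ergodic inequality, for a measurable function. -/
theorem measure_exists_lt_birkhoffAverage_le_of_measurable [IsProbabilityMeasure μ]
    (hT : MeasurePreserving T μ μ) {u : Ω → ℝ} (hm : Measurable u) (hu : Integrable u μ) {c : ℝ}
    (hc : 0 < c) :
    μ {x | ∃ k, c < |birkhoffAverage ℝ T u k x|} ≤ ENNReal.ofReal ((∫ x, |u x| ∂μ) / c) := by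
  set h : Ω → ℝ := fun x => |u x| - c with hdef
  have hhm : Measurable h := (measurable_norm.comp hm).sub_const c
  have hhi : Integrable h μ := hu.abs.sub (integrable_const c)
  let E : ℕ → Set Ω := fun n => {x | 0 < maxBirkhoffSum T h n x}
  have hEm : ∀ n, MeasurableSet (E n) := fun n =>
    measurableSet_lt measurable_const (measurable_maxBirkhoffSum hT.measurable hhm _)
  have hmono : Monotone E := monotone_nat_of_le_succ fun n x hx =>
    lt_of_lt_of_le hx (maxBirkhoffSum_le_succ T h n x)
  have hsub : {x | ∃ k, c < |birkhoffAverage ℝ T u k x|} ⊆ ⋃ n, E n := by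
    rintro x ⟨k, hk⟩
    have hk0 : 0 < k := by
      rcases Nat.eq_zero_or_pos k with rfl | h
      · simp at hk
        exact absurd hk (not_lt.2 hc.le)
      · exact h
    refine mem_iUnion.2 ⟨k, lt_of_lt_of_le ?_ (birkhoffSum_le_maxBirkhoffSum T h le_rfl x)⟩
    rw [hdef, birkhoffSum_sub_const]
    have h1 : |birkhoffAverage ℝ T u k x| ≤ (k : ℝ)⁻¹ * birkhoffSum T (fun x => |u x|) k x := by
      rw [birkhoffAverage, smul_eq_mul, abs_mul,
        abs_of_nonneg (by positivity : (0 : ℝ) ≤ (k : ℝ)⁻¹)]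
      exact mul_le_mul_of_nonneg_left (Finset.abs_sum_le_sum_abs _ _) (by positivity)
    have hk1 : (0 : ℝ) < k := by exact_mod_cast hk0
    have h2 := hk.trans_le h1
    rw [inv_mul_eq_div, lt_div_iff₀ hk1] at h2
    linarith
  refine (measure_mono hsub).trans ?_
  rw [hmono.measure_iUnion]
  refine iSup_le fun n => ?_
  have h1 := setIntegral_nonneg_of_maxBirkhoffSum_pos hT hhm hhi n
  have h2 : ∫ x in E n, h x ∂μ = ∫ x in E n, |u x| ∂μ - μ.real (E n) * c := by
    rw [hdef, integral_sub hu.abs.integrableOn (integrable_const c), setIntegral_const,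
      smul_eq_mul]
  have h3 : ∫ x in E n, |u x| ∂μ ≤ ∫ x, |u x| ∂μ :=
    setIntegral_le_integral hu.abs (Filter.Eventually.of_forall fun x => abs_nonneg _)
  have h4 : μ.real (E n) ≤ (∫ x, |u x| ∂μ) / c := by
    rw [le_div_iff₀ hc]
    have h1' : 0 ≤ ∫ x in E n, h x ∂μ := h1
    linarith
  rw [← ofReal_measureReal]
  exact ENNReal.ofReal_le_ofReal h4

/-- The maximal ergodic inequality. -/
theorem measure_exists_lt_birkhoffAverage_le [IsProbabilityMeasure μ]
    (hT : MeasurePreserving T μ μ) {u : Ω → ℝ} (hu : Integrable u μ) {c : ℝ} (hc : 0 < c) :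
    μ {x | ∃ k, c < |birkhoffAverage ℝ T u k x|} ≤ ENNReal.ofReal ((∫ x, |u x| ∂μ) / c) := by
  obtain ⟨v, hv, huv⟩ := hu.aestronglyMeasurable
  have h1 : ∀ᵐ x ∂μ, ∀ k, birkhoffAverage ℝ T u k x = birkhoffAverage ℝ T v k x :=
    ae_all_iff.2 fun k =>
      hT.quasiMeasurePreserving.birkhoffAverage_ae_eq_of_ae_eq ℝ huv k
  have h2 : ∫ x, |u x| ∂μ = ∫ x, |v x| ∂μ :=
    integral_congr_ae (huv.mono fun x hx => by beta_reduce; rw [hx])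
  rw [h2]
  refine le_trans (measure_mono_ae ?_)
    (measure_exists_lt_birkhoffAverage_le_of_measurable hT hv.measurable (hu.congr huv) hc)
  filter_upwards [h1] with x hx
  rintro ⟨k, hk⟩
  exact ⟨k, by rwa [hx k] at hk⟩

theorem integrable_birkhoffSum (hT : MeasurePreserving T μ μ) {u : Ω → ℝ} (hu : Integrable u μ)
    (n : ℕ) : Integrable (birkhoffSum T u n) μ := by
  induction n with
  | zero => simp only [birkhoffSum_zero']; exact integrable_zero Ω ℝ μ
  | succ n ih =>
    have : birkhoffSum T u (n + 1) = fun x => birkhoffSum T u n x + u (T^[n] x) :=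
      funext fun x => birkhoffSum_succ T u n x
    rw [this]
    exact ih.add ((hT.iterate n).integrable_comp_of_integrable hu)

theorem integrable_birkhoffAverage (hT : MeasurePreserving T μ μ) {u : Ω → ℝ}
    (hu : Integrable u μ) (n : ℕ) : Integrable (birkhoffAverage ℝ T u n) μ :=
  (integrable_birkhoffSum hT hu n).smul ((n : ℝ)⁻¹)

theorem integral_comp_iterate (hT : MeasurePreserving T μ μ) {u : Ω → ℝ} (hu : Integrable u μ)
    (n : ℕ) : ∫ x, u (T^[n] x) ∂μ = ∫ x, u x ∂μ := by
  have hn := hT.iterate n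
  have := integral_map (μ := μ) hn.measurable.aemeasurable (f := u)
    (by rw [hn.map_eq]; exact hu.aestronglyMeasurable)
  rw [hn.map_eq] at this
  exact this.symm

theorem integral_birkhoffAverage (hT : MeasurePreserving T μ μ) {u : Ω → ℝ}
    (hu : Integrable u μ) {n : ℕ} (hn : n ≠ 0) :
    ∫ x, birkhoffAverage ℝ T u n x ∂μ = ∫ x, u x ∂μ := by
  have h : ∫ x, birkhoffSum T u n x ∂μ = n * ∫ x, u x ∂μ := by
    simp only [birkhoffSum]
    have hk : ∀ k, Integrable (fun x => u (T^[k] x)) μ := fun k =>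
      (hT.iterate k).integrable_comp_of_integrable hu
    rw [integral_finsetSum _ fun k _ => hk k]
    simp [integral_comp_iterate hT hu]
  simp only [birkhoffAverage]
  rw [integral_smul, h, smul_eq_mul, ← mul_assoc, inv_mul_cancel₀ (by exact_mod_cast hn), one_mul]

end Ergodic

section MeanErgodic

open Filter Topology

variable {Ω : Type*} [MeasurableSpace Ω] {μ : Measure Ω} {T : Ω → Ω}

/-- The mean ergodic theorem: for a square integrable `g` and an ergodic map, the Birkhoff averages
converge in measure to the integral of `g`. -/
theorem tendstoInMeasure_birkhoffAverage [IsProbabilityMeasure μ] (hT : Ergodic T μ) {g : Ω → ℝ}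
    (hg : MemLp g 2 μ) :
    TendstoInMeasure μ (birkhoffAverage ℝ T g) atTop (fun _ => ∫ x, g x ∂μ) := by
  have hTm : MeasurePreserving T μ μ := hT.toMeasurePreserving
  have hgi : Integrable g μ := hg.integrable one_le_two
  -- the Koopman operator on `L²`
  let U : Lp ℝ 2 μ →L[ℝ] Lp ℝ 2 μ :=
    (Lp.compMeasurePreservingₗᵢ ℝ T hTm).toContinuousLinearMap
  have hU : ∀ v : Lp ℝ 2 μ, U v = Lp.compMeasurePreserving T hTm v := fun v => rfl
  have hUn : ‖U‖ ≤ 1 := LinearIsometry.norm_toContinuousLinearMap_le _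
  have hlim := U.tendsto_birkhoffAverage_orthogonalProjection hUn (hg.toLp g)
  set P : Lp ℝ 2 μ := ((U.eqLocus (1 : Lp ℝ 2 μ →L[ℝ] Lp ℝ 2 μ)).orthogonalProjectionOnto
    (hg.toLp g) : Lp ℝ 2 μ) with hPdef
  have hP : U P = P :=
    ((U.eqLocus (1 : Lp ℝ 2 μ →L[ℝ] Lp ℝ 2 μ)).orthogonalProjectionOnto (hg.toLp g)).2
  have hPc : (P : Ω → ℝ) ∘ T =ᵐ[μ] P := by
    have h1 := Lp.coeFn_compMeasurePreserving P hTm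
    rw [← hU, hP] at h1
    exact h1.symm
  obtain ⟨c, hc⟩ := hT.ae_eq_const_of_ae_eq_comp_ae (Lp.aestronglyMeasurable P) hPc
  have hUk : ∀ k : ℕ, U^[k] (hg.toLp g) =ᵐ[μ] fun x => g (T^[k] x) := by
    intro k
    have : U^[k] (hg.toLp g) = Lp.compMeasurePreserving T^[k] (hTm.iterate k) (hg.toLp g) := by
      rw [← Lp.compMeasurePreserving_iterate]
      rfl
    rw [this]
    refine (Lp.coeFn_compMeasurePreserving _ _).trans ?_
    exact (hTm.iterate k).quasiMeasurePreserving.ae_eq_comp hg.coeFn_toLp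
  have hS : ∀ n : ℕ, (birkhoffSum U _root_.id n (hg.toLp g) : Lp ℝ 2 μ) =ᵐ[μ]
      birkhoffSum T g n := by
    intro n
    induction n with
    | zero => simpa using Lp.coeFn_zero ℝ 2 μ
    | succ n ih =>
      rw [birkhoffSum_succ]
      filter_upwards [Lp.coeFn_add (birkhoffSum U _root_.id n (hg.toLp g))
        (_root_.id (U^[n] (hg.toLp g))), ih, hUk n] with x h1 h2 h3
      rw [h1, Pi.add_apply, h2, birkhoffSum_succ]
      exact congrArg _ h3
  have hA : ∀ n : ℕ, (birkhoffAverage ℝ U _root_.id n (hg.toLp g) : Lp ℝ 2 μ) =ᵐ[μ]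
      birkhoffAverage ℝ T g n := by
    intro n
    filter_upwards [Lp.coeFn_smul ((n : ℝ)⁻¹) (birkhoffSum U _root_.id n (hg.toLp g)),
      hS n] with x h1 h2
    rw [birkhoffAverage, h1, Pi.smul_apply, h2]
    rfl
  have hL2 : Tendsto (fun n => eLpNorm (birkhoffAverage ℝ T g n - fun _ => c) 2 μ) atTop (𝓝 0) := by
    refine ((Lp.tendsto_Lp_iff_tendsto_eLpNorm' _ _).1 hlim).congr fun n => ?_
    exact eLpNorm_congr_ae ((hA n).sub hc)
  have hmeas : ∀ n, AEStronglyMeasurable (birkhoffAverage ℝ T g n - fun _ => c) μ := fun n =>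
    (integrable_birkhoffAverage hTm hgi n).aestronglyMeasurable.sub aestronglyMeasurable_const
  have hL1 : Tendsto (fun n => eLpNorm (birkhoffAverage ℝ T g n - fun _ => c) 1 μ) atTop
      (𝓝 0) :=
    tendsto_of_tendsto_of_tendsto_of_le_of_le tendsto_const_nhds hL2 (fun _ => zero_le)
      fun n => eLpNorm_le_eLpNorm_of_exponent_le one_le_two (hmeas n)
  have hint := tendsto_integral_of_L1' (μ := μ) (fun _ => c) aestronglyMeasurable_const
    (Eventually.of_forall fun n => integrable_birkhoffAverage hTm hgi n) hL1
  have hcg : c = ∫ x, g x ∂μ := by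
    refine tendsto_nhds_unique (a := c) ?_ (tendsto_const_nhds (x := ∫ x, g x ∂μ)
      (f := (atTop : Filter ℕ)))
    have h2 : ∫ _, c ∂μ = c := by simp
    rw [h2] at hint
    refine hint.congr' ?_
    filter_upwards [eventually_ne_atTop 0] with n hn
    exact integral_birkhoffAverage hTm hgi hn
  rw [← hcg]
  exact tendstoInMeasure_of_tendsto_eLpNorm two_ne_zero
    (fun n => (integrable_birkhoffAverage hTm hgi n).aestronglyMeasurable)
    aestronglyMeasurable_const hL2

end MeanErgodic

section Rate

variable {Ω : Type*}

theorem abs_birkhoffSum_iterate_sub_le (T : Ω → Ω) {g : Ω → ℝ} {K : ℝ} (hK : ∀ x, |g x| ≤ K)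
    (n j : ℕ) (x : Ω) : |birkhoffSum T g n (T^[j] x) - birkhoffSum T g n x| ≤ 2 * j * K := by
  induction j with
  | zero => simp
  | succ j ih =>
    have h1 := birkhoffSum_apply_sub_birkhoffSum T g n (T^[j] x)
    rw [Function.iterate_succ_apply']
    have h2 : birkhoffSum T g n (T (T^[j] x)) - birkhoffSum T g n x =
        (g (T^[n] (T^[j] x)) - g (T^[j] x)) +
          (birkhoffSum T g n (T^[j] x) - birkhoffSum T g n x) := by
      rw [← h1]; ring
    rw [h2]
    have h3 := abs_add_le (g (T^[n] (T^[j] x)) - g (T^[j] x))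
      (birkhoffSum T g n (T^[j] x) - birkhoffSum T g n x)
    have h4 := abs_sub (g (T^[n] (T^[j] x))) (g (T^[j] x))
    have h5 := hK (T^[n] (T^[j] x))
    have h6 := hK (T^[j] x)
    push_cast
    linarith

theorem birkhoffSum_birkhoffSum (T : Ω → Ω) (g : Ω → ℝ) (n p : ℕ) (x : Ω) :
    birkhoffSum T (birkhoffSum T g p) n x = ∑ j ∈ Finset.range p, birkhoffSum T g n (T^[j] x) := by
  simp only [birkhoffSum]
  rw [Finset.sum_comm]
  refine Finset.sum_congr rfl fun j _ => Finset.sum_congr rfl fun i _ => ?_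
  rw [← Function.iterate_add_apply, ← Function.iterate_add_apply, add_comm]

theorem birkhoffAverage_sub_apply (T : Ω → Ω) (u v : Ω → ℝ) (n : ℕ) (x : Ω) :
    birkhoffAverage ℝ T (fun y => u y - v y) n x =
      birkhoffAverage ℝ T u n x - birkhoffAverage ℝ T v n x := by
  simp [birkhoffAverage, birkhoffSum, Finset.sum_sub_distrib, mul_sub]

theorem birkhoffAverage_const {n : ℕ} (hn : n ≠ 0) (T : Ω → Ω) (c : ℝ) (x : Ω) :
    birkhoffAverage ℝ T (fun _ => c) n x = c := by
  have : (n : ℝ) ≠ 0 := by exact_mod_cast hn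
  simp [birkhoffAverage, birkhoffSum, this]

/-- Averaging a bounded function over `p` steps changes its averages over `n ≫ p` steps only
slightly. -/
theorem abs_birkhoffAverage_sub_birkhoffAverage_le (T : Ω → Ω) {g : Ω → ℝ} {K : ℝ}
    (hK : ∀ x, |g x| ≤ K) {n p : ℕ} (hn : n ≠ 0) (hp : p ≠ 0) (x : Ω) :
    |birkhoffAverage ℝ T g n x - birkhoffAverage ℝ T (birkhoffAverage ℝ T g p) n x| ≤
      2 * p * K / n := by
  have hn' : (0 : ℝ) < n := by exact_mod_cast Nat.pos_of_ne_zero hn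
  have hp' : (0 : ℝ) < p := by exact_mod_cast Nat.pos_of_ne_zero hp
  have hK0 : 0 ≤ K := (abs_nonneg _).trans (hK x)
  have h1 : birkhoffAverage ℝ T (birkhoffAverage ℝ T g p) n x =
      (n : ℝ)⁻¹ * ((p : ℝ)⁻¹ * ∑ j ∈ Finset.range p, birkhoffSum T g n (T^[j] x)) := by
    rw [← birkhoffSum_birkhoffSum]
    simp only [birkhoffAverage, birkhoffSum, smul_eq_mul, Finset.mul_sum]
  have h2 : birkhoffAverage ℝ T g n x =
      (n : ℝ)⁻¹ * ((p : ℝ)⁻¹ * ∑ j ∈ Finset.range p, birkhoffSum T g n x) := by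
    rw [Finset.sum_const, Finset.card_range, nsmul_eq_mul, ← mul_assoc (p : ℝ)⁻¹,
      inv_mul_cancel₀ hp'.ne', one_mul, birkhoffAverage, smul_eq_mul]
  rw [h1, h2, ← mul_sub, ← mul_sub, ← Finset.sum_sub_distrib, abs_mul, abs_mul,
    abs_of_pos (inv_pos.2 hn'), abs_of_pos (inv_pos.2 hp')]
  have h3 : |∑ j ∈ Finset.range p, (birkhoffSum T g n x - birkhoffSum T g n (T^[j] x))| ≤
      p * (2 * p * K) := by
    refine (Finset.abs_sum_le_sum_abs _ _).trans ?_
    refine (Finset.sum_le_card_nsmul _ _ (2 * p * K) fun j hj => ?_).trans ?_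
    · rw [abs_sub_comm]
      refine (abs_birkhoffSum_iterate_sub_le T hK n j x).trans ?_
      have : (j : ℝ) ≤ p := by exact_mod_cast (Finset.mem_range.1 hj).le
      gcongr
    · simp
  rw [inv_mul_eq_div, inv_mul_eq_div, div_le_div_iff_of_pos_right hn', div_le_iff₀ hp']
  linarith

theorem abs_birkhoffAverage_le (T : Ω → Ω) {g : Ω → ℝ} {K : ℝ} (hK : ∀ x, |g x| ≤ K) {p : ℕ}
    (hp : 0 < p) (x : Ω) : |birkhoffAverage ℝ T g p x| ≤ K := by
  have hp' : (0 : ℝ) < p := by exact_mod_cast hp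
  rw [birkhoffAverage, smul_eq_mul, abs_mul, abs_of_pos (inv_pos.2 hp'), inv_mul_le_iff₀ hp']
  refine (Finset.abs_sum_le_sum_abs _ _).trans ?_
  refine (Finset.sum_le_card_nsmul _ _ K fun k _ => hK _).trans_eq (by simp)

variable [MeasurableSpace Ω] {μ : Measure Ω} {T : Ω → Ω}

theorem integral_abs_sub_le_of_distL1_le {f g : Ω → ℝ} (hf : Integrable f μ) (hg : Integrable g μ)
    {e : ℝ} (he : 0 ≤ e) (h : distL1 μ g f ≤ ENNReal.ofReal e) : ∫ x, |f x - g x| ∂μ ≤ e := by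
  have h1 : ∫ x, |f x - g x| ∂μ = (eLpNorm (g - f) 1 μ).toReal := by
    rw [eLpNorm_one_eq_lintegral_enorm, ← integral_norm_eq_lintegral_enorm
      (hg.sub hf).aestronglyMeasurable]
    refine integral_congr_ae (Filter.Eventually.of_forall fun x => ?_)
    simp only [Pi.sub_apply, Real.norm_eq_abs]
    exact abs_sub_comm _ _
  rw [h1]
  exact ENNReal.toReal_le_of_le_ofReal he h

/-- If `f` is close in `L¹` to a bounded function `g`, and the averages of `g` over `p` steps are
close in `L¹` to a constant, then from an explicit time on the averages of `f` stay close to the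
integral of `f` outside a small set. -/
theorem measure_le_tailSup_le [IsProbabilityMeasure μ] (hT : MeasurePreserving T μ μ)
    {f g : Ω → ℝ} (hf : Integrable f μ) (hg : Integrable g μ) {K : ℝ} (hK : ∀ x, |g x| ≤ K)
    {p : ℕ} (hp : p ≠ 0) {I η ε : ℝ} (hε : 0 < ε)
    (hη : ∫ x, |f x - g x| ∂μ + ∫ x, |birkhoffAverage ℝ T g p x - I| ∂μ ≤ η) (hηε : η ≤ ε / 4)
    {n : ℕ} (hn : n ≠ 0) (hnK : 8 * p * K ≤ ε * n) :
    μ {x | ENNReal.ofReal ε ≤ tailSup (birkhoffAverage ℝ T f) (fun _ => ∫ y, f y ∂μ) n x} ≤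
      ENNReal.ofReal (η / (ε / 4)) := by
  have hAg := integrable_birkhoffAverage hT hg p
  -- the part of `f - I` whose averages are controlled by the maximal inequality
  let w : Ω → ℝ := fun x => (f x - g x) + (birkhoffAverage ℝ T g p x - I)
  have hw : Integrable w μ := (hf.sub hg).add (hAg.sub (integrable_const I))
  have hwη : ∫ x, |w x| ∂μ ≤ η := by
    refine le_trans ?_ hη
    have h1 : Integrable (fun x => |f x - g x|) μ := (hf.sub hg).abs
    have h2 : Integrable (fun x => |birkhoffAverage ℝ T g p x - I|) μ :=
      (hAg.sub (integrable_const I)).abs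
    rw [← integral_add h1 h2]
    exact integral_mono hw.abs (h1.add h2) fun x => abs_add_le _ _
  have hwi : ∫ x, w x ∂μ = ∫ x, f x ∂μ - I := by
    have h1 : ∫ x, w x ∂μ = ∫ x, (f x - g x) ∂μ + ∫ x, (birkhoffAverage ℝ T g p x - I) ∂μ :=
      integral_add (hf.sub hg) (hAg.sub (integrable_const I))
    rw [h1, integral_sub hf hg, integral_sub hAg (integrable_const I),
      integral_birkhoffAverage hT hg hp]
    simp
  have hfI : |∫ x, f x ∂μ - I| ≤ ε / 4 := by
    rw [← hwi]
    exact (abs_integral_le_integral_abs).trans (hwη.trans hηε)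
  refine le_trans (measure_mono ?_) ((measure_exists_lt_birkhoffAverage_le hT hw
    (by positivity : 0 < ε / 4)).trans (ENNReal.ofReal_le_ofReal ?_))
  · intro x hx
    by_contra hcon
    have hcon' : ∀ k, |birkhoffAverage ℝ T w k x| ≤ ε / 4 := fun k =>
      not_lt.1 fun h => hcon ⟨k, h⟩
    refine absurd (show ENNReal.ofReal ε ≤ _ from hx) (not_le.2 ?_)
    refine lt_of_le_of_lt (b := ENNReal.ofReal (3 * (ε / 4))) ?_
      ((ENNReal.ofReal_lt_ofReal_iff hε).2 (by linarith))
    refine iSup₂_le fun k hk => ENNReal.ofReal_le_ofReal ?_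
    have hk0 : k ≠ 0 := by omega
    have hk' : (0 : ℝ) < k := by exact_mod_cast Nat.pos_of_ne_zero hk0
    have h1 := abs_birkhoffAverage_sub_birkhoffAverage_le T hK hk0 hp x
    have h2 : 2 * p * K / k ≤ ε / 4 := by
      rw [div_le_iff₀ hk']
      have : (n : ℝ) ≤ k := by exact_mod_cast hk
      have := mul_le_mul_of_nonneg_left this hε.le
      linarith
    have h3 : birkhoffAverage ℝ T w k x = birkhoffAverage ℝ T f k x - birkhoffAverage ℝ T g k x +
        (birkhoffAverage ℝ T (birkhoffAverage ℝ T g p) k x - I) := by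
      have : w = (fun x => f x - g x) + fun x => birkhoffAverage ℝ T g p x - I := rfl
      rw [this, birkhoffAverage_add, Pi.add_apply, Pi.add_apply, birkhoffAverage_sub_apply,
        birkhoffAverage_sub_apply, birkhoffAverage_const hk0]
    have h4 : birkhoffAverage ℝ T f k x - ∫ y, f y ∂μ = birkhoffAverage ℝ T w k x +
        (birkhoffAverage ℝ T g k x - birkhoffAverage ℝ T (birkhoffAverage ℝ T g p) k x) -
          (∫ y, f y ∂μ - I) := by
      rw [h3]; ring
    rw [h4]
    refine (abs_sub _ _).trans ?_
    have h5 := abs_add_le (birkhoffAverage ℝ T w k x)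
      (birkhoffAverage ℝ T g k x - birkhoffAverage ℝ T (birkhoffAverage ℝ T g p) k x)
    have h6 := hcon' k
    linarith
  · gcongr

end Rate

/-! ### Measures close in the Wasserstein-Kantorovich distance -/

section Measures

variable {X : Type*} [MetricSpace X] [MeasurableSpace X]

theorem W₁_comm (μ ν : Measure X) : W₁ μ ν = W₁ ν μ := by
  simp only [W₁, abs_sub_comm]

variable [BorelSpace X]

/-- One half of the comparison between the Wasserstein-Kantorovich distance and Prokhorov's. -/
theorem measureReal_le_thickening_add {μ ν : Measure X} [IsProbabilityMeasure μ]
    [IsProbabilityMeasure ν] {e κ : ℝ} (he : 0 ≤ e) (hκ : 0 < κ) (h : W₁ μ ν ≤ ENNReal.ofReal e)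
    {S : Set X} (hS : MeasurableSet S) :
    μ.real S ≤ ν.real (Metric.thickening κ S) + e / κ := by
  rcases S.eq_empty_or_nonempty with rfl | hne
  · simp only [measureReal_empty]
    positivity
  let F : X → ℝ := fun x => max 0 (κ - Metric.infDist x S)
  have hF : LipschitzWith 1 F := by
    refine LipschitzWith.of_le_add fun x y => ?_
    have h1 := Metric.infDist_le_infDist_add_dist (s := S) (x := y) (y := x)
    rw [dist_comm] at h1
    refine max_le (add_nonneg (le_max_left _ _) dist_nonneg) ?_
    have h2 : κ - Metric.infDist y S ≤ F y := le_max_right _ _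
    linarith
  have hF0 : ∀ x, 0 ≤ F x := fun x => le_max_left _ _
  have hFκ : ∀ x, F x ≤ κ := fun x =>
    max_le hκ.le (by linarith [Metric.infDist_nonneg (x := x) (s := S)])
  have hFabs : ∀ x, |F x| ≤ κ := fun x => by rw [abs_of_nonneg (hF0 x)]; exact hFκ x
  have hFi : ∀ ρ : Measure X, IsProbabilityMeasure ρ → Integrable F ρ := fun ρ _ =>
    Integrable.of_bound hF.continuous.measurable.aestronglyMeasurable κ
      (Filter.Eventually.of_forall hFabs)
  have hd : ∫ x, F x ∂μ - ∫ x, F x ∂ν ≤ e := by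
    have h1 : ENNReal.ofReal |∫ x, F x ∂μ - ∫ x, F x ∂ν| ≤ ENNReal.ofReal e := by
      refine le_trans ?_ h
      unfold W₁
      exact le_iSup_of_le F (le_iSup_of_le hF (le_iSup_of_le ⟨κ, hFabs⟩ le_rfl))
    exact (le_abs_self _).trans ((ENNReal.ofReal_le_ofReal_iff he).1 h1)
  have h1 : κ * μ.real S ≤ ∫ x, F x ∂μ := by
    have : ∫ x, S.indicator (fun _ => κ) x ∂μ = κ * μ.real S := by
      rw [integral_indicator_const _ hS, smul_eq_mul, mul_comm]
    rw [← this]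
    refine integral_mono ((integrable_const κ).indicator hS) (hFi μ inferInstance) fun x => ?_
    by_cases hx : x ∈ S
    · rw [indicator_of_mem hx]
      have : Metric.infDist x S = 0 := Metric.infDist_zero_of_mem hx
      simp [F, this]
    · rw [indicator_of_notMem hx]
      exact hF0 x
  have h2 : ∫ x, F x ∂ν ≤ κ * ν.real (Metric.thickening κ S) := by
    have hU : MeasurableSet (Metric.thickening κ S) := Metric.isOpen_thickening.measurableSet
    have : ∫ x, (Metric.thickening κ S).indicator (fun _ => κ) x ∂ν =
        κ * ν.real (Metric.thickening κ S) := by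
      rw [integral_indicator_const _ hU, smul_eq_mul, mul_comm]
    rw [← this]
    refine integral_mono (hFi ν inferInstance) ((integrable_const κ).indicator hU) fun x => ?_
    by_cases hx : x ∈ Metric.thickening κ S
    · rw [indicator_of_mem hx]
      exact hFκ x
    · rw [indicator_of_notMem hx]
      have h3 : κ ≤ Metric.infDist x S := by
        by_contra hlt
        exact hx ((Metric.mem_thickening_iff_infDist_lt hne).2 (not_le.1 hlt))
      exact max_le le_rfl (by linarith)
  have h3 : κ * (e / κ) = e := by field_simp
  nlinarith

end Measures

section IdealMeasures

variable {X : Type*} [MetricSpace X] [ComputableMetricSpace X]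

/-- The weight of the atoms in the set `s` in the ideal measure with number `A`. -/
noncomputable def weightIn (s : Set X) (A : (ℕ × ℕ) × List (ℕ × ℕ)) : ℕ :=
  open Classical in
  ((A.1 :: A.2).map fun t =>
    if ComputableMetricSpace.ideal t.2 ∈ s then t.1 + 1 else 0).sum

theorem totalWeight_pos (A : (ℕ × ℕ) × List (ℕ × ℕ)) : 0 < totalWeight A := by
  simp [totalWeight]

theorem weightIn_le_weightOutside (G : List ℕ) (A : (ℕ × ℕ) × List (ℕ × ℕ)) :
    weightIn ((ComputableMetricSpace.ideal '' {i | i ∈ G})ᶜ : Set X) A ≤ weightOutside G A := by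
  classical
  refine List.sum_le_sum fun t _ => ?_
  by_cases ht : t.2 ∈ G
  · simp [ht, mem_image_of_mem ComputableMetricSpace.ideal (show t.2 ∈ {i | i ∈ G} from ht)]
  · rw [if_neg ht]
    split_ifs <;> simp

open Classical in
theorem weightOutside_filter (s : Set X) (A : (ℕ × ℕ) × List (ℕ × ℕ)) :
    weightOutside (((A.1 :: A.2).map Prod.snd).filter
      fun i => (ComputableMetricSpace.ideal i : X) ∈ s) A = weightIn sᶜ A := by
  unfold weightOutside weightIn
  congr 1
  refine List.map_congr_left fun t ht => ?_
  by_cases hs : (ComputableMetricSpace.ideal t.2 : X) ∈ s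
  · rw [if_pos, if_neg (by simpa using hs)]
    simp only [List.mem_filter, decide_eq_true_eq]
    exact ⟨List.mem_map_of_mem ht, hs⟩
  · rw [if_neg, if_pos (by simpa using hs)]
    simp [hs]

variable [MeasurableSpace X]

theorem idealMeasure_apply (A : (ℕ × ℕ) × List (ℕ × ℕ)) {s : Set X} (hs : MeasurableSet s) :
    idealMeasure A s = (totalWeight A : ℝ≥0∞)⁻¹ * weightIn s A := by
  classical
  have h1 : ∀ l : List (ℕ × ℕ), (l.map fun t => ((t.1 : ℝ≥0∞) + 1)).sum =
      ((l.map fun t => t.1 + 1).sum : ℕ) := by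
    intro l
    induction l with
    | nil => simp
    | cons t l ih => simp only [List.map_cons, List.sum_cons, ih]; push_cast; rfl
  have h2 : ∀ l : List (ℕ × ℕ), (l.map fun t =>
      ((t.1 : ℝ≥0∞) + 1) • Measure.dirac (ComputableMetricSpace.ideal t.2 : X)).sum s =
      ((l.map fun t => if ComputableMetricSpace.ideal t.2 ∈ s then t.1 + 1 else 0).sum : ℕ) := by
    intro l
    induction l with
    | nil => simp
    | cons t l ih =>
      simp only [List.map_cons, List.sum_cons, Measure.add_apply, ih, Measure.smul_apply,
        Measure.dirac_apply' _ hs, smul_eq_mul]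
      by_cases ht : ComputableMetricSpace.ideal t.2 ∈ s
      · simp [ht]
      · simp [ht]
  rw [idealMeasure, Measure.smul_apply, h1, h2, smul_eq_mul, weightIn, totalWeight]

instance isProbabilityMeasure_idealMeasure (A : (ℕ × ℕ) × List (ℕ × ℕ)) :
    IsProbabilityMeasure (idealMeasure A : Measure X) := by
  constructor
  rw [idealMeasure_apply A MeasurableSet.univ]
  have h : weightIn (univ : Set X) A = totalWeight A := by simp [weightIn, totalWeight]
  rw [h]
  exact ENNReal.inv_mul_cancel (by exact_mod_cast (totalWeight_pos A).ne') (by simp)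

theorem measureReal_idealMeasure (A : (ℕ × ℕ) × List (ℕ × ℕ)) {s : Set X}
    (hs : MeasurableSet s) :
    (idealMeasure A).real s = weightIn s A / totalWeight A := by
  rw [measureReal_def, idealMeasure_apply A hs, ENNReal.toReal_mul, ENNReal.toReal_inv,
    ENNReal.toReal_natCast, ENNReal.toReal_natCast, inv_mul_eq_div]

end IdealMeasures

/-! ### Codes of rational numbers and values of ideal functions -/

section Codes

theorem posNum_sub_negNum (q : ℚ) :
    ((posNum (encode q) : ℤ) - negNum (encode q) : ℤ) = q.num := by
  rw [encode_rat]
  unfold posNum negNum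
  rw [Nat.unpair_pair]
  rcases hq : q.num with k | k
  · have : encode (Int.ofNat k) = 2 * k := rfl
    rw [this]
    simp
  · have : encode (Int.negSucc k) = 2 * k + 1 := rfl
    rw [this]
    have h1 : (2 * k + 1) % 2 = 1 := by omega
    have h2 : (2 * k + 1) / 2 = k := by omega
    simp only [h1, h2]
    simp [Int.negSucc_eq]

theorem posNum_mul_negNum (n : ℕ) : posNum n = 0 ∨ negNum n = 0 := by
  unfold posNum negNum
  rcases Nat.mod_two_eq_zero_or_one n.unpair.1 with h | h <;> simp [h]

theorem denom_encode (q : ℚ) : denom (encode q) = q.den := by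
  rw [encode_rat, denom, Nat.unpair_pair]

theorem denom_encode_pos (q : ℚ) : 0 < denom (encode q) := by
  rw [denom_encode]; exact q.den_pos

theorem ratCast_eq (q : ℚ) :
    (q : ℝ) = ((posNum (encode q) : ℝ) - negNum (encode q)) / denom (encode q) := by
  rw [denom_encode]
  have h := posNum_sub_negNum q
  have h' : ((posNum (encode q) : ℝ) - negNum (encode q)) = (q.num : ℝ) := by exact_mod_cast h
  rw [h', Rat.cast_def]

theorem max_ratCast_zero (q : ℚ) :
    max (q : ℝ) 0 = (posNum (encode q) : ℝ) / denom (encode q) := by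
  have hd : (0 : ℝ) < denom (encode q) := by exact_mod_cast denom_encode_pos q
  rw [ratCast_eq]
  rcases posNum_mul_negNum (encode q) with h | h
  · rw [h, max_eq_right]
    · simp
    · refine div_nonpos_of_nonpos_of_nonneg ?_ hd.le
      simp
  · rw [h, max_eq_left]
    · simp
    · simp only [CharP.cast_eq_zero, sub_zero]
      positivity

theorem posRat_eq (r : PosRat) :
    ((r : ℚ) : ℝ) = (posNum (encode r) : ℝ) / denom (encode r) := by
  rw [Subtype.encode_eq, ← max_ratCast_zero, max_eq_left]
  exact_mod_cast r.2.le

theorem posRat_pos (r : PosRat) : (0 : ℝ) < ((r : ℚ) : ℝ) := by exact_mod_cast r.2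

theorem denom_encode_posRat_pos (r : PosRat) : 0 < denom (encode r) := by
  rw [Subtype.encode_eq]; exact denom_encode_pos _

theorem posNum_encode_posRat_pos (r : PosRat) : 0 < posNum (encode r) := by
  have h := posRat_pos r
  rw [posRat_eq] at h
  rcases Nat.eq_zero_or_pos (posNum (encode r)) with h0 | h0
  · simp [h0] at h
  · exact h0

theorem inv_denom_le (r : PosRat) : 1 / (denom (encode r) : ℝ) ≤ ((r : ℚ) : ℝ) := by
  rw [posRat_eq]
  have h1 : (1 : ℝ) ≤ posNum (encode r) := by exact_mod_cast posNum_encode_posRat_pos r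
  gcongr

/-- The positive rational number `1 / (m + 1)`. -/
def unitRat (m : ℕ) : PosRat := ⟨1 / ((m : ℚ) + 1), by positivity⟩

theorem cast_unitRat (m : ℕ) : ((unitRat m : ℚ) : ℝ) = 1 / ((m : ℝ) + 1) := by
  simp [unitRat]

theorem encode_unitRat (m : ℕ) : encode (unitRat m) = unitCode m := by
  have h : (1 / ((m : ℚ) + 1)) = ((m + 1 : ℕ) : ℚ)⁻¹ := by push_cast; simp
  rw [Subtype.encode_eq]
  change encode (1 / ((m : ℚ) + 1)) = _
  rw [h, encode_rat, Rat.inv_natCast_num_of_pos (by omega), Rat.inv_natCast_den_of_pos (by omega)]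
  rfl

/-- The number of a bump function, with rational numbers replaced by their codes. -/
def codeBump (b : ℕ × PosRat × PosRat) : ℕ × ℕ × ℕ := (b.1, encode b.2.1, encode b.2.2)

/-- The number of an ideal function, with rational numbers replaced by their codes. This does not
change how it is encoded by a natural number, see `encode_codeFun`. -/
def codeFun (l : List (ℚ × List (ℕ × PosRat × PosRat))) : FunCode :=
  l.map fun t => (encode t.1, t.2.map codeBump)

theorem encode_codeFun (l : List (ℚ × List (ℕ × PosRat × PosRat))) :
    encode (codeFun l) = encode l := by
  have h1 : ∀ bs : List (ℕ × PosRat × PosRat), encode (bs.map codeBump) = encode bs := by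
    intro bs
    induction bs with
    | nil => rfl
    | cons b bs ih => simp only [List.map_cons, encode_list_cons, ih]; rfl
  induction l with
  | nil => rfl
  | cons t l ih =>
    simp only [codeFun, List.map_cons, encode_list_cons] at ih ⊢
    rw [ih]
    simp only [encode_prod_val, h1, encode_nat]
    rfl

/-- The number represented by a signed fraction. -/
noncomputable def SignedFrac.val (x : SignedFrac) : ℝ := ((x.1 : ℝ) - x.2.1) / x.2.2

theorem SignedFrac.val_add {x y : SignedFrac} (hx : 0 < x.2.2) (hy : 0 < y.2.2) :
    (x.add y).val = x.val + y.val := by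
  have hx' : (0 : ℝ) < x.2.2 := by exact_mod_cast hx
  have hy' : (0 : ℝ) < y.2.2 := by exact_mod_cast hy
  simp only [SignedFrac.val, SignedFrac.add]
  push_cast
  field_simp
  ring

theorem SignedFrac.val_sum {l : List SignedFrac} (h : ∀ x ∈ l, 0 < x.2.2) :
    0 < (SignedFrac.sum l).2.2 ∧ (SignedFrac.sum l).val = (l.map SignedFrac.val).sum := by
  induction l with
  | nil => simp [SignedFrac.sum, SignedFrac.val]
  | cons x l ih =>
    have ih' := ih fun y hy => h y (List.mem_cons_of_mem _ hy)
    have hx := h x List.mem_cons_self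
    refine ⟨Nat.mul_pos hx ih'.1, ?_⟩
    have : SignedFrac.sum (x :: l) = x.add (SignedFrac.sum l) := rfl
    rw [this, SignedFrac.val_add hx ih'.1, ih'.2, List.map_cons, List.sum_cons]

/-- The profile of a bump function: its value at distance `d` from the centre. -/
noncomputable def bumpProfile (r η d : ℝ) : ℝ := max 0 (1 - max 0 (d - r) / η)

theorem bumpProfile_mem {r η : ℝ} (hη : 0 < η) (d : ℝ) :
    0 ≤ bumpProfile r η d ∧ bumpProfile r η d ≤ 1 := by
  refine ⟨le_max_left _ _, max_le zero_le_one ?_⟩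
  have : 0 ≤ max 0 (d - r) / η := div_nonneg (le_max_left _ _) hη.le
  linarith

theorem abs_bumpProfile_sub_le {r η : ℝ} (hη : 0 < η) (d d' : ℝ) :
    |bumpProfile r η d - bumpProfile r η d'| ≤ |d - d'| / η := by
  have h1 : |max 0 (d' - r) - max 0 (d - r)| ≤ |d - d'| := by
    have := abs_max_sub_max_le_max 0 (d' - r) 0 (d - r)
    refine this.trans ?_
    rw [sub_zero, abs_zero, sub_sub_sub_cancel_right, abs_sub_comm]
    exact max_le (abs_nonneg _) le_rfl
  have h2 := abs_max_sub_max_le_max 0 (1 - max 0 (d - r) / η) 0 (1 - max 0 (d' - r) / η)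
  refine h2.trans (max_le ?_ ?_)
  · rw [sub_zero, abs_zero]
    positivity
  · have : 1 - max 0 (d - r) / η - (1 - max 0 (d' - r) / η) =
        (max 0 (d' - r) - max 0 (d - r)) / η := by ring
    rw [this, abs_div, abs_of_pos hη]
    gcongr

theorem natCast_tsub_eq (a b : ℕ) : ((a - b : ℕ) : ℝ) = max 0 ((a : ℝ) - b) := by
  rcases le_total b a with h | h
  · rw [Nat.cast_sub h, max_eq_right]
    have : (b : ℝ) ≤ a := by exact_mod_cast h
    linarith
  · rw [Nat.sub_eq_zero_of_le h, max_eq_left]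
    · simp
    · have : (a : ℝ) ≤ b := by exact_mod_cast h
      linarith

theorem bumpNum_div_bumpDen (b : ℕ × PosRat × PosRat) {q : ℕ} (hq : 0 < denom q) :
    0 < bumpDen (codeBump b) q ∧ (bumpNum (codeBump b) q : ℝ) / bumpDen (codeBump b) q =
      bumpProfile ((b.2.1 : ℚ) : ℝ) ((b.2.2 : ℚ) : ℝ) ((posNum q : ℝ) / denom q) := by
  have hr := denom_encode_posRat_pos b.2.1
  have hh := denom_encode_posRat_pos b.2.2
  have hh' := posNum_encode_posRat_pos b.2.2
  have hD : 0 < bumpDen (codeBump b) q := Nat.mul_pos (Nat.mul_pos hq hr) hh'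
  refine ⟨hD, ?_⟩
  have hq1 : (0 : ℝ) < denom q := by exact_mod_cast hq
  have hr1 : (0 : ℝ) < denom (encode b.2.1) := by exact_mod_cast hr
  have hh1 : (0 : ℝ) < denom (encode b.2.2) := by exact_mod_cast hh
  have hh2 : (0 : ℝ) < posNum (encode b.2.2) := by exact_mod_cast hh'
  have hD1 : (0 : ℝ) < bumpDen (codeBump b) q := by exact_mod_cast hD
  have hDe : (bumpDen (codeBump b) q : ℝ) =
      denom q * denom (encode b.2.1) * posNum (encode b.2.2) := by
    simp [bumpDen, codeBump]
  rw [bumpNum, natCast_tsub_eq, Nat.cast_mul, natCast_tsub_eq, bumpProfile, posRat_eq b.2.1,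
    posRat_eq b.2.2, ← max_div_div_right hD1.le, zero_div]
  congr 1
  have h1 : max 0 ((posNum q : ℝ) / denom q - posNum (encode b.2.1) / denom (encode b.2.1)) =
      max 0 (((posNum q * denom (codeBump b).2.1 : ℕ) : ℝ) -
        ((posNum (codeBump b).2.1 * denom q : ℕ) : ℝ)) / (denom q * denom (encode b.2.1)) := by
    rw [← max_div_div_right (by positivity), zero_div]
    congr 1
    simp only [codeBump]
    push_cast
    field_simp
  rw [h1, hDe]
  simp only [codeBump]
  field_simp

variable {X : Type*} [MetricSpace X] [ComputableMetricSpace X]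

theorem bump_eq_bumpProfile (b : ℕ × PosRat × PosRat) (x : X) :
    bump b x = bumpProfile ((b.2.1 : ℚ) : ℝ) ((b.2.2 : ℚ) : ℝ)
      (dist x (ComputableMetricSpace.ideal b.1)) := rfl

theorem bump_mem (b : ℕ × PosRat × PosRat) (x : X) : 0 ≤ bump b x ∧ bump b x ≤ 1 :=
  bumpProfile_mem (posRat_pos b.2.2) _

theorem prod_bump_mem (bs : List (ℕ × PosRat × PosRat)) (x : X) :
    0 ≤ (bs.map fun b => bump b x).prod ∧ (bs.map fun b => bump b x).prod ≤ 1 := by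
  induction bs with
  | nil => simp
  | cons b bs ih =>
    have h := bump_mem b x
    simp only [List.map_cons, List.prod_cons]
    exact ⟨mul_nonneg h.1 ih.1, mul_le_one₀ h.2 ih.1 ih.2⟩

theorem abs_bump_sub_le (b : ℕ × PosRat × PosRat) (x : X) {q : ℕ} (hq : 0 < denom q) {e : ℝ}
    (he : |(posNum q : ℝ) / denom q - dist x (ComputableMetricSpace.ideal b.1)| ≤ e) :
    |bump b x - (bumpNum (codeBump b) q : ℝ) / bumpDen (codeBump b) q| ≤
      denom (encode b.2.2) * e := by
  rw [bump_eq_bumpProfile, (bumpNum_div_bumpDen b hq).2]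
  have hη := posRat_pos b.2.2
  refine (abs_bumpProfile_sub_le hη _ _).trans ?_
  rw [abs_sub_comm, div_le_iff₀ hη]
  have hd : (0 : ℝ) < denom (encode b.2.2) := by exact_mod_cast denom_encode_posRat_pos b.2.2
  have h1 := inv_denom_le b.2.2
  rw [div_le_iff₀ hd] at h1
  have he0 : 0 ≤ e := (abs_nonneg _).trans he
  nlinarith [mul_le_mul_of_nonneg_right h1 he0]

theorem prod_bump_approx (bs : List (ℕ × PosRat × PosRat)) (x : X) {e : ℝ}
    (Bs : List ((ℕ × ℕ × ℕ) × ℕ)) (hBs : Bs.map Prod.fst = bs.map codeBump)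
    (h : ∀ b ∈ Bs, 0 < denom b.2 ∧
      |(posNum b.2 : ℝ) / denom b.2 - dist x (ComputableMetricSpace.ideal b.1.1)| ≤ e) :
    0 < (Bs.map fun b => bumpDen b.1 b.2).prod ∧
    |((Bs.map fun b => bumpNum b.1 b.2).prod : ℝ) / (Bs.map fun b => bumpDen b.1 b.2).prod| ≤ 1 ∧
    |(bs.map fun b => bump b x).prod -
      ((Bs.map fun b => bumpNum b.1 b.2).prod : ℝ) / (Bs.map fun b => bumpDen b.1 b.2).prod| ≤
        ((bs.map codeBump).map fun b => denom b.2.2).sum * e := by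
  induction bs generalizing Bs with
  | nil =>
    obtain rfl : Bs = [] := by simpa using hBs
    simp
  | cons b bs ih =>
    cases Bs with
    | nil => simp at hBs
    | cons B Bs =>
      simp only [List.map_cons, List.cons.injEq] at hBs
      obtain ⟨hB, hBs⟩ := hBs
      obtain ⟨h1, h2, h3⟩ := ih Bs hBs fun c hc => h c (List.mem_cons_of_mem _ hc)
      obtain ⟨hq, hqe⟩ := h B List.mem_cons_self
      rw [hB] at hqe
      have g1 := bumpNum_div_bumpDen b hq
      have g2 := abs_bump_sub_le b x hq hqe
      have g3 := bumpProfile_mem (r := ((b.2.1 : ℚ) : ℝ)) (posRat_pos b.2.2)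
        ((posNum B.2 : ℝ) / denom B.2)
      rw [← g1.2] at g3
      have g4 := bump_mem b x
      simp only [List.map_cons, List.prod_cons, List.sum_cons, hB, Nat.cast_mul, Nat.cast_add]
      rw [mul_div_mul_comm]
      set u : ℝ := (bumpNum (codeBump b) B.2 : ℝ) / bumpDen (codeBump b) B.2
      set v : ℝ := ((Bs.map fun b => bumpNum b.1 b.2).prod : ℝ) /
        ((Bs.map fun b => bumpDen b.1 b.2).prod : ℕ)
      refine ⟨Nat.mul_pos g1.1 h1, ?_, ?_⟩
      · rw [abs_mul, abs_of_nonneg g3.1]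
        exact mul_le_one₀ g3.2 (abs_nonneg _) h2
      · have : bump b x * (bs.map fun b => bump b x).prod - u * v =
            bump b x * ((bs.map fun b => bump b x).prod - v) + (bump b x - u) * v := by ring
        rw [this]
        refine (abs_add_le _ _).trans ?_
        rw [abs_mul, abs_mul, abs_of_nonneg g4.1]
        have k1 := mul_le_of_le_one_left (abs_nonneg ((bs.map fun b => bump b x).prod - v)) g4.2
        have k2 := mul_le_of_le_one_right (abs_nonneg (bump b x - u)) h2
        have k3 : (codeBump b).2.2 = encode b.2.2 := rfl
        rw [k3, add_mul]
        linarith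

theorem abs_ratCast_le (c : ℚ) : |(c : ℝ)| ≤ posNum (encode c) + negNum (encode c) := by
  have hd : (1 : ℝ) ≤ denom (encode c) := by exact_mod_cast denom_encode_pos c
  rw [ratCast_eq, abs_div, abs_of_pos (by linarith : (0 : ℝ) < denom (encode c))]
  refine (div_le_self (abs_nonneg _) hd).trans ((abs_sub _ _).trans ?_)
  rw [Nat.abs_cast, Nat.abs_cast]

/-- The value computed from approximate distances is accurate up to `funBound` times the error of
the distances. -/
theorem abs_idealFun_sub_evalCode_le (l : List (ℚ × List (ℕ × PosRat × PosRat))) (x : X) {e : ℝ}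
    (he : 0 ≤ e) (L : List (ℕ × List ((ℕ × ℕ × ℕ) × ℕ)))
    (hL : L.map (fun t => (t.1, t.2.map Prod.fst)) = codeFun l)
    (h : ∀ t ∈ L, ∀ b ∈ t.2, 0 < denom b.2 ∧
      |(posNum b.2 : ℝ) / denom b.2 - dist x (ComputableMetricSpace.ideal b.1.1)| ≤ e) :
    0 < (evalCode L).2.2 ∧ |idealFun l x - (evalCode L).val| ≤ funBound (codeFun l) * e := by
  induction l generalizing L with
  | nil =>
    obtain rfl : L = [] := by simpa [codeFun] using hL
    simp [evalCode, SignedFrac.sum, SignedFrac.val, idealFun, funBound, codeFun]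
  | cons t l ih =>
    cases L with
    | nil => simp [codeFun] at hL
    | cons u L =>
      simp only [codeFun, List.map_cons, List.cons.injEq] at hL
      obtain ⟨hu, hL⟩ := hL
      obtain ⟨hu1, hu2⟩ := Prod.mk.inj hu
      obtain ⟨h1, h2⟩ := ih L hL fun c hc => h c (List.mem_cons_of_mem _ hc)
      obtain ⟨g1, g2, g3⟩ := prod_bump_approx t.2 x u.2 hu2 (h u List.mem_cons_self)
      set N := (u.2.map fun b => bumpNum b.1 b.2).prod
      set D := (u.2.map fun b => bumpDen b.1 b.2).prod
      let T : SignedFrac := (posNum u.1 * N, negNum u.1 * N, denom u.1 * D)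
      have hev : evalCode (u :: L) = T.add (evalCode L) := rfl
      have hT0 : 0 < T.2.2 := by
        refine Nat.mul_pos ?_ g1
        rw [hu1]; exact denom_encode_pos _
      have hT : T.val = (t.1 : ℝ) * ((N : ℝ) / D) := by
        rw [ratCast_eq t.1, ← hu1]
        simp only [T, SignedFrac.val]
        push_cast
        rw [← sub_mul, mul_div_mul_comm]
      have hid : idealFun (t :: l) x =
          (t.1 : ℝ) * (t.2.map fun b => bump b x).prod + idealFun l x := by
        simp [idealFun]
      have hfb : (funBound (codeFun (t :: l)) : ℝ) =
          ((posNum (encode t.1) : ℝ) + negNum (encode t.1)) *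
            (1 + ((t.2.map codeBump).map fun b => denom b.2.2).sum) + funBound (codeFun l) := by
        simp [funBound, codeFun]
      rw [hev]
      refine ⟨Nat.mul_pos hT0 h1, ?_⟩
      rw [SignedFrac.val_add hT0 h1, hT, hid, hfb]
      have hsplit : (t.1 : ℝ) * (t.2.map fun b => bump b x).prod + idealFun l x -
          ((t.1 : ℝ) * ((N : ℝ) / D) + (evalCode L).val) =
          (t.1 : ℝ) * ((t.2.map fun b => bump b x).prod - (N : ℝ) / D) +
            (idealFun l x - (evalCode L).val) := by ring
      rw [hsplit, add_mul]
      refine (abs_add_le _ _).trans (add_le_add ?_ h2)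
      rw [abs_mul, mul_assoc]
      refine mul_le_mul (abs_ratCast_le t.1) (g3.trans ?_) (abs_nonneg _) (by positivity)
      gcongr
      linarith

theorem abs_idealFun_le (l : List (ℚ × List (ℕ × PosRat × PosRat))) (x : X) :
    |idealFun l x| ≤ funBound (codeFun l) := by
  induction l with
  | nil => simp [idealFun]
  | cons t l ih =>
    have hid : idealFun (t :: l) x =
        (t.1 : ℝ) * (t.2.map fun b => bump b x).prod + idealFun l x := by
      simp [idealFun]
    have hfb : (funBound (codeFun (t :: l)) : ℝ) =
        ((posNum (encode t.1) : ℝ) + negNum (encode t.1)) *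
          (1 + ((t.2.map codeBump).map fun b => denom b.2.2).sum) + funBound (codeFun l) := by
      simp [funBound, codeFun]
    rw [hid, hfb]
    refine (abs_add_le _ _).trans (add_le_add ?_ ih)
    have hp := prod_bump_mem t.2 x
    rw [abs_mul, abs_of_nonneg hp.1]
    refine mul_le_mul (abs_ratCast_le t.1) (hp.2.trans ?_) hp.1 (by positivity)
    exact le_add_of_nonneg_right (Nat.cast_nonneg _)

theorem continuous_idealFun (l : List (ℚ × List (ℕ × PosRat × PosRat))) :
    Continuous (idealFun l : X → ℝ) := by
  have hb : ∀ b : ℕ × PosRat × PosRat, Continuous (bump b : X → ℝ) := fun b => by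
    unfold bump
    fun_prop
  unfold idealFun
  refine continuous_list_sum _ fun t _ => continuous_const.mul ?_
  exact continuous_list_prod _ fun b _ => hb b

end Codes

/-! ### Meaning of the certificates -/

/-- The program `cd` computes the distances between the ideal points of `X`. -/
def ComputesDist (X : Type*) [MetricSpace X] [ComputableMetricSpace X] (cd : Code) : Prop :=
  ∀ i j n : ℕ, ∃ q : ℚ, encode q ∈ cd.eval (encode (i, j, n)) ∧
    |(q : ℝ) - dist (ComputableMetricSpace.ideal i : X) (ComputableMetricSpace.ideal j)| <
      (2 : ℝ)⁻¹ ^ n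

theorem isPosCode_encode (r : PosRat) : IsPosCode (encode r) := by
  refine ⟨⟨posNum_encode_posRat_pos r, denom_encode_posRat_pos r⟩, ?_⟩
  have hd := denom_encode_posRat_pos r
  have hneg : negNum (encode r) = 0 :=
    (posNum_mul_negNum _).resolve_left (posNum_encode_posRat_pos r).ne'
  have hco : Nat.Coprime (posNum (encode r)) (denom (encode r)) := by
    have h1 := posNum_sub_negNum (r : ℚ)
    rw [← Subtype.encode_eq, hneg] at h1
    have h2 : (r : ℚ).num.natAbs = posNum (encode r) := by
      rw [← h1]; simp
    rw [← h2, Subtype.encode_eq, denom_encode]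
    exact (r : ℚ).reduced
  rcases Nat.lt_or_ge 1 (denom (encode r)) with h1 | h1
  · obtain ⟨u, hu⟩ := Nat.exists_mul_mod_eq_one_of_coprime hco h1
    refine ⟨u, posNum (encode r) * u / denom (encode r), ?_⟩
    have := Nat.div_add_mod (posNum (encode r) * u) (denom (encode r))
    omega
  · have h2 : denom (encode r) = 1 := by omega
    have h3 := posNum_encode_posRat_pos r
    exact ⟨1, posNum (encode r) - 1, by rw [h2]; omega⟩

theorem IsPosCode.exists_encode_eq {q : ℕ} (h : IsPosCode q) : ∃ r : PosRat, encode r = q := by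
  obtain ⟨⟨h1, h2⟩, u, v, huv⟩ := h
  have hco : Nat.Coprime (posNum q) (denom q) := by
    rw [Nat.coprime_iff_gcd_eq_one, ← Nat.dvd_one]
    have k1 := (Nat.gcd_dvd_left (posNum q) (denom q)).mul_right u
    have k2 := (Nat.gcd_dvd_right (posNum q) (denom q)).mul_right v
    rw [huv] at k1
    exact (Nat.dvd_add_right k2).1 k1
  have hq : q = Nat.pair (2 * posNum q) (denom q) := by
    have k : q.unpair.1 = 2 * posNum q := by
      unfold posNum at h1 ⊢
      rcases Nat.mod_two_eq_zero_or_one q.unpair.1 with h | h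
      · rw [h]; omega
      · rw [h] at h1; simp at h1
    rw [← k]
    exact (Nat.pair_unpair q).symm
  let r : ℚ := ⟨posNum q, denom q, h2.ne', by simpa using hco⟩
  have hr : 0 < r := Rat.num_pos.1 (by simpa [r] using h1)
  refine ⟨⟨r, hr⟩, ?_⟩
  rw [Subtype.encode_eq, encode_rat]
  conv_rhs => rw [hq]
  rfl

theorem inv_two_pow_le (n : ℕ) : (2 : ℝ)⁻¹ ^ n ≤ 1 / ((n : ℝ) + 1) := by
  rw [inv_pow, ← one_div]
  have : n + 1 ≤ 2 ^ n := Nat.lt_two_pow_self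
  have h : (n : ℝ) + 1 ≤ 2 ^ n := by exact_mod_cast this
  gcongr

section Space

variable {X : Type*} [MetricSpace X] [ComputableMetricSpace X] {cd : Code}

open ComputableMetricSpace (ideal)

/-- Taking the positive part of an approximation to a distance does not make it worse. -/
theorem abs_posNum_div_denom_sub_le (q : ℚ) {d e : ℝ} (hd : 0 ≤ d) (h : |(q : ℝ) - d| ≤ e) :
    |(posNum (encode q) : ℝ) / denom (encode q) - d| ≤ e := by
  rw [← max_ratCast_zero]
  have h1 := abs_max_sub_max_le_abs (q : ℝ) d 0
  rw [max_eq_left hd] at h1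
  exact h1.trans h

theorem inside_iff (hcd : ComputesDist X cd) (i j : ℕ) (r r' : PosRat) :
    Inside cd i j (encode r) (encode r') ↔
      dist (ideal i : X) (ideal j) + ((r : ℚ) : ℝ) < ((r' : ℚ) : ℝ) := by
  have hr : (0 : ℝ) < denom (encode r) := by exact_mod_cast denom_encode_posRat_pos r
  have hr' : (0 : ℝ) < denom (encode r') := by exact_mod_cast denom_encode_posRat_pos r'
  have key : ∀ (n : ℕ) (q : ℚ),
      ((posNum (encode q) * (n + 1) * denom (encode r) + denom (encode q) * denom (encode r) +
        posNum (encode r) * denom (encode q) * (n + 1)) * denom (encode r') <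
          posNum (encode r') * denom (encode q) * (n + 1) * denom (encode r)) ↔
      (posNum (encode q) : ℝ) / denom (encode q) + 1 / ((n : ℝ) + 1) + ((r : ℚ) : ℝ) <
        ((r' : ℚ) : ℝ) := by
    intro n q
    have hq : (0 : ℝ) < denom (encode q) := by exact_mod_cast denom_encode_pos q
    have hn : (0 : ℝ) < (n : ℝ) + 1 := by positivity
    rw [posRat_eq r, posRat_eq r', ← Nat.cast_lt (α := ℝ), div_add_div _ _ hq.ne' hn.ne',
      div_add_div _ _ (by positivity) hr.ne', div_lt_div_iff₀ (by positivity) hr']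
    push_cast
    constructor <;> intro h <;> linarith
  constructor
  · rintro ⟨n, d, hd, h⟩
    obtain ⟨q, hq, hqd⟩ := hcd i j n
    obtain rfl : d = encode q := Part.mem_unique hd hq
    rw [key] at h
    have h1 := abs_posNum_div_denom_sub_le q dist_nonneg hqd.le
    have h2 := (abs_le.1 h1).1
    have h3 := inv_two_pow_le n
    linarith
  · intro h
    obtain ⟨n, hn⟩ := exists_nat_one_div_lt (half_pos (sub_pos.2 h))
    obtain ⟨q, hq, hqd⟩ := hcd i j n
    refine ⟨n, encode q, hq, ?_⟩
    rw [key]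
    have h1 := abs_posNum_div_denom_sub_le q dist_nonneg hqd.le
    have h2 := (abs_le.1 h1).2
    have h3 := inv_two_pow_le n
    linarith

/-- The ball underlying a marked ball. -/
def MarkedBall.toSet (c : MarkedBall) : Set X := Metric.ball (ideal c.1) (1 / ((c.2.1 : ℝ) + 1))

theorem idealBall_unitRat (c : MarkedBall) :
    idealBall (c.1, unitRat c.2.1) = (c.toSet : Set X) := by
  rw [idealBall, MarkedBall.toSet, cast_unitRat]

theorem exists_evaluates (hcd : ComputesDist X cd)
    (l : List (ℚ × List (ℕ × PosRat × PosRat))) (j n : ℕ) :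
    ∃ v, Evaluates cd (codeFun l) j n v := by
  choose q hq _ using hcd
  refine ⟨_, (codeFun l).map (fun t => (t.1, t.2.map fun b => (b, encode (q b.1 j n)))), ?_, ?_,
    rfl⟩
  · simp [Function.comp_def]
  · intro t ht b hb
    obtain ⟨t', _, rfl⟩ := List.mem_map.1 ht
    obtain ⟨b', _, rfl⟩ := List.mem_map.1 hb
    exact hq b'.1 j n

theorem Evaluates.abs_sub_le (hcd : ComputesDist X cd)
    {l : List (ℚ × List (ℕ × PosRat × PosRat))} {j n : ℕ} {v : SignedFrac}
    (h : Evaluates cd (codeFun l) j n v) {x : X} {ρ : ℝ} (hx : dist x (ideal j) ≤ ρ) :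
    0 < v.2.2 ∧ |idealFun l x - v.val| ≤ funBound (codeFun l) * ((2 : ℝ)⁻¹ ^ n + ρ) := by
  obtain ⟨L, hL, hLe, rfl⟩ := h
  have hρ : 0 ≤ ρ := dist_nonneg.trans hx
  refine abs_idealFun_sub_evalCode_le l x (by positivity) L hL fun t ht b hb => ?_
  obtain ⟨q, hq, hqd⟩ := hcd b.1.1 j n
  have hbq := Part.mem_unique (hLe t ht b hb) hq
  rw [hbq]
  refine ⟨denom_encode_pos q, abs_posNum_div_denom_sub_le q dist_nonneg ?_⟩
  have h1 : (q : ℝ) - dist x (ideal b.1.1) =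
      ((q : ℝ) - dist (ideal b.1.1 : X) (ideal j)) +
        (dist (ideal b.1.1 : X) (ideal j) - dist x (ideal b.1.1)) := by ring
  rw [h1]
  refine (abs_add_le _ _).trans (add_le_add hqd.le (le_trans ?_ hx))
  rw [dist_comm x (ideal j), dist_comm x (ideal b.1.1), dist_comm (ideal j) x,
    dist_comm (ideal b.1.1) (ideal j), dist_comm (ideal b.1.1) x, dist_comm x (ideal j)]
  exact abs_dist_sub_le _ _ _

theorem mul_inv_le_of_mul_le {K S k : ℕ} (hS : 0 < S) (h : K * (2 * S) ≤ k + 1) :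
    (K : ℝ) * (1 / ((k : ℝ) + 1)) ≤ 1 / (2 * S) := by
  have hS' : (0 : ℝ) < S := by exact_mod_cast hS
  have h' : (K : ℝ) * (2 * S) ≤ k + 1 := by exact_mod_cast h
  rw [mul_one_div, div_le_div_iff₀ (by positivity) (by positivity)]
  linarith

theorem WellMarked.abs_sub_le (hcd : ComputesDist X cd)
    {l : List (ℚ × List (ℕ × PosRat × PosRat))} {S : ℕ} (hS : 0 < S) {c : MarkedBall}
    (h : WellMarked cd (codeFun l) S c) {x : X} (hx : x ∈ c.toSet) :
    0 < c.2.2.2.2 ∧ |idealFun l x - c.2.2.val| ≤ 1 / S := by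
  obtain ⟨n, hev, h1, h2⟩ := h
  obtain ⟨h3, h4⟩ := hev.abs_sub_le hcd (Metric.mem_ball.1 hx).le
  refine ⟨h3, h4.trans ?_⟩
  rw [mul_add]
  have h5 := mul_inv_le_of_mul_le hS h1
  have h6 := mul_inv_le_of_mul_le hS h2
  have h7 : (funBound (codeFun l) : ℝ) * (2 : ℝ)⁻¹ ^ n ≤
      funBound (codeFun l) * (1 / ((n : ℝ) + 1)) :=
    mul_le_mul_of_nonneg_left (inv_two_pow_le n) (Nat.cast_nonneg _)
  have h8 : (1 : ℝ) / (2 * S) + 1 / (2 * S) = 1 / S := by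
    have : (S : ℝ) ≠ 0 := by exact_mod_cast hS.ne'
    field_simp
    norm_num
  linarith

/-- Around any point there are well marked balls, inside any given ball. -/
theorem exists_wellMarked (hcd : ComputesDist X cd)
    (l : List (ℚ × List (ℕ × PosRat × PosRat))) (S : ℕ) {x y : X} {r : ℝ} (hx : dist x y < r) :
    ∃ c : MarkedBall, WellMarked cd (codeFun l) S c ∧ x ∈ c.toSet ∧
      dist (ideal c.1) y + 1 / ((c.2.1 : ℝ) + 1) < r := by
  obtain ⟨m₀, hm₀⟩ := exists_nat_one_div_lt (half_pos (sub_pos.2 hx))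
  let m := max m₀ (funBound (codeFun l) * (2 * S))
  have hm : 1 / ((m : ℝ) + 1) ≤ 1 / ((m₀ : ℝ) + 1) := by
    have : (m₀ : ℝ) ≤ m := by exact_mod_cast le_max_left _ _
    gcongr
  have hmK : funBound (codeFun l) * (2 * S) ≤ m + 1 := (le_max_right _ _).trans (Nat.le_succ _)
  obtain ⟨j, hj⟩ := ComputableMetricSpace.dense_ideal.exists_dist_lt x
    (by positivity : (0 : ℝ) < 1 / ((m : ℝ) + 1))
  obtain ⟨v, hv⟩ := exists_evaluates hcd l j (funBound (codeFun l) * (2 * S))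
  refine ⟨(j, m, v), ⟨_, hv, Nat.le_succ _, hmK⟩, hj, ?_⟩
  have := dist_triangle_left (ideal j) y x
  change dist (ideal j) y + 1 / ((m : ℝ) + 1) < r
  linarith

theorem sum_map_eq_sum_range {α : Type*} (C : List α) (f : α → ℝ) (d : α) :
    (C.map f).sum = ∑ k ∈ Finset.range C.length, f (C.getD k d) := by
  induction C with
  | nil => simp
  | cons c C ih =>
    rw [List.length_cons, Finset.sum_range_succ', List.map_cons, List.sum_cons, ih, add_comm]
    simp

/-- The constant `(I.1 - I.2) / S`. -/
noncomputable def meanVal (S : ℕ) (I : ℕ × ℕ) : ℝ := ((I.1 : ℝ) - I.2) / S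

theorem meanNear_iff {S : ℕ} (hS : 0 < S) (I : ℕ × ℕ) {C : List MarkedBall}
    (hC : ∀ c ∈ C, 0 < c.2.2.2.2) :
    MeanNear S I C ↔ |(C.map fun c => c.2.2.val).sum - C.length * meanVal S I| ≤
      C.length * (3 / S) := by
  have hv := SignedFrac.val_sum (l := C.map fun c => c.2.2) fun y hy => by
    obtain ⟨c, hc, rfl⟩ := List.mem_map.1 hy
    exact hC c hc
  rw [List.map_map] at hv
  have hv2 : (C.map fun c => c.2.2.val).sum = (SignedFrac.sum (C.map fun c => c.2.2)).val :=
    hv.2.symm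
  rw [hv2]
  have hD : (0 : ℝ) < (SignedFrac.sum (C.map fun c => c.2.2)).2.2 := by exact_mod_cast hv.1
  have hS' : (0 : ℝ) < S := by exact_mod_cast hS
  unfold MeanNear SignedFrac.val meanVal
  generalize SignedFrac.sum (C.map fun c => c.2.2) = w at hD
  obtain ⟨P, N, D⟩ := w
  simp only at hD ⊢
  have e1 : ((P : ℝ) - N) / D - C.length * (((I.1 : ℝ) - I.2) / S) =
      (((P : ℝ) - N) * S - C.length * (I.1 - I.2) * D) / (D * S) := by
    field_simp
  have e2 : (C.length : ℝ) * (3 / S) = (C.length * 3 * D) / (D * S) := by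
    field_simp
  rw [e1, e2, abs_div, abs_of_pos (by positivity : (0 : ℝ) < D * S),
    div_le_div_iff_of_pos_right (by positivity), abs_le, ← Nat.cast_le (α := ℝ),
    ← Nat.cast_le (α := ℝ)]
  push_cast
  constructor
  · rintro ⟨h1, h2⟩
    constructor <;> linarith
  · rintro ⟨h1, h2⟩
    constructor <;> linarith

theorem IsOrbitChain.denom_pos (hcd : ComputesDist X cd)
    {l : List (ℚ × List (ℕ × PosRat × PosRat))} {t : Code} {S : ℕ} (hS : 0 < S)
    {C : List MarkedBall} (hC : IsOrbitChain cd t (codeFun l) S C) {c : MarkedBall}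
    (hc : c ∈ C) : 0 < c.2.2.2.2 := by
  refine ((hC.1 c hc).abs_sub_le (X := X) hcd hS (x := ideal c.1) ?_).1
  exact Metric.mem_ball_self (by positivity)

/-- The set of points around which, with a margin `κ`, a chain of `p` balls shows that the Birkhoff
averages over `p` steps are close to the constant `meanVal S I`. -/
def certifiedSet (X : Type*) [MetricSpace X] [ComputableMetricSpace X] (cd t : Code) (l : FunCode)
    (S p : ℕ) (I : ℕ × ℕ) (κ : ℝ) : Set X :=
  {x | ∃ C : List MarkedBall, C.length = p ∧ IsOrbitChain cd t l S C ∧ MeanNear S I C ∧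
    dist x (ideal (C.getD 0 default).1) + κ < 1 / (((C.getD 0 default).2.1 : ℝ) + 1)}

theorem goodPoint_iff (hcd : ComputesDist X cd) {t : Code} {l : FunCode} {S p : ℕ} {I : ℕ × ℕ}
    {m i : ℕ} : GoodPoint cd t l S p I m i ↔
      (ideal i : X) ∈ certifiedSet X cd t l S p I (1 / ((m : ℝ) + 1)) := by
  unfold GoodPoint
  simp only [← encode_unitRat, inside_iff (X := X) hcd, cast_unitRat]
  rfl

theorem isOpen_certifiedSet (t : Code) (l : FunCode) (S p : ℕ) (I : ℕ × ℕ) (κ : ℝ) :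
    IsOpen (certifiedSet X cd t l S p I κ) := by
  have : certifiedSet X cd t l S p I κ = ⋃ C : List MarkedBall,
      {x | (C.length = p ∧ IsOrbitChain cd t l S C ∧ MeanNear S I C) ∧
        dist x (ideal (C.getD 0 default).1) + κ <
          1 / (((C.getD 0 default).2.1 : ℝ) + 1)} := by
    ext x
    simp only [certifiedSet, mem_ofPred_eq, mem_iUnion, and_assoc]
  rw [this]
  refine isOpen_iUnion fun C => ?_
  rw [ofPred_and]
  refine isOpen_const.inter (isOpen_lt ?_ continuous_const)
  fun_prop

theorem certifiedSet_anti (t : Code) (l : FunCode) (S p : ℕ) (I : ℕ × ℕ) {κ κ' : ℝ}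
    (h : κ ≤ κ') : certifiedSet X cd t l S p I κ' ⊆ certifiedSet X cd t l S p I κ := by
  rintro x ⟨C, h1, h2, h3, h4⟩
  exact ⟨C, h1, h2, h3, by linarith⟩

theorem thickening_certifiedSet_subset (t : Code) (l : FunCode) (S p : ℕ) (I : ℕ × ℕ) (κ : ℝ) :
    Metric.thickening κ (certifiedSet X cd t l S p I (2 * κ)) ⊆ certifiedSet X cd t l S p I κ := by
  intro x hx
  obtain ⟨y, ⟨C, h1, h2, h3, h4⟩, hxy⟩ := Metric.mem_thickening_iff.1 hx
  refine ⟨C, h1, h2, h3, ?_⟩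
  have := dist_triangle x y (ideal (C.getD 0 default).1)
  linarith

variable [MeasurableSpace X] {μ : Measure X} {T : X → X} {pT : Code × Code}

theorem MapsInto.mem (hcd : ComputesDist X cd) (hpT : DescribesAEMap μ pT T) {c c' : MarkedBall}
    (h : MapsInto cd pT.2 c c') {x : X} (hx : x ∈ c.toSet) (hD : x ∈ effectiveGδ pT.1) :
    T x ∈ (c'.toSet : Set X) := by
  obtain ⟨n, j, q, hev, hq, hin⟩ := h
  obtain ⟨r, rfl⟩ := hq.exists_encode_eq
  rw [← encode_unitRat, inside_iff (X := X) hcd, cast_unitRat] at hin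
  have h1 : x ∈ effectiveOpen pT.2 (c'.1, unitRat c'.2.1) ∩ effectiveGδ pT.1 := by
    refine ⟨⟨n, (j, r), ?_, ?_⟩, hD⟩
    · rw [← encode_unitRat] at hev
      exact hev
    · have h2 : dist x (ideal c.1) < 1 / ((c.2.1 : ℝ) + 1) := hx
      have h3 := dist_triangle x (ideal c.1) (ideal j)
      change dist x (ideal j) < ((r : ℚ) : ℝ)
      linarith
  rw [← hpT.2, idealBall_unitRat] at h1
  exact h1.1

theorem exists_mapsInto (hcd : ComputesDist X cd) (hpT : DescribesAEMap μ pT T)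
    (l : List (ℚ × List (ℕ × PosRat × PosRat))) (S : ℕ) {x : X} {c' : MarkedBall}
    (hx : T x ∈ (c'.toSet : Set X)) (hD : x ∈ effectiveGδ pT.1) :
    ∃ c : MarkedBall, WellMarked cd (codeFun l) S c ∧ x ∈ (c.toSet : Set X) ∧
      MapsInto cd pT.2 c c' := by
  have h1 : x ∈ T ⁻¹' idealBall (c'.1, unitRat c'.2.1) ∩ effectiveGδ pT.1 := by
    rw [idealBall_unitRat]
    exact ⟨hx, hD⟩
  rw [hpT.2] at h1
  obtain ⟨⟨n, ⟨j, r⟩, hev, hxb⟩, -⟩ := h1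
  obtain ⟨c, hc, hxc, hcr⟩ := exists_wellMarked hcd l S (show dist x (ideal j) < ((r : ℚ) : ℝ)
    from hxb)
  refine ⟨c, hc, hxc, n, j, encode r, ?_, isPosCode_encode r, ?_⟩
  · rw [← encode_unitRat]
    exact hev
  · rw [← encode_unitRat, inside_iff (X := X) hcd, cast_unitRat]
    exact hcr

theorem IsOrbitChain.iterate_mem (hcd : ComputesDist X cd) (hpT : DescribesAEMap μ pT T)
    {l : FunCode} {S : ℕ} {C : List MarkedBall} (hC : IsOrbitChain cd pT.2 l S C) {x : X}
    (hx : x ∈ ((C.getD 0 default).toSet : Set X)) (hD : ∀ k, T^[k] x ∈ effectiveGδ pT.1) {k : ℕ}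
    (hk : k < C.length) : T^[k] x ∈ ((C.getD k default).toSet : Set X) := by
  induction k with
  | zero => exact hx
  | succ k ih =>
    rw [Function.iterate_succ_apply']
    exact (hC.2 k (List.mem_range.2 (by omega))).mem hcd hpT (ih (by omega)) (hD k)

/-- The orbit of a point in the domain of computability is accompanied by a chain of well marked
balls. The chain is built backwards, since only preimages of balls are computable. -/
theorem exists_isOrbitChain (hcd : ComputesDist X cd) (hpT : DescribesAEMap μ pT T)
    (l : List (ℚ × List (ℕ × PosRat × PosRat))) (S p : ℕ) {x : X}
    (hD : ∀ k, T^[k] x ∈ effectiveGδ pT.1) :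
    ∃ C : List MarkedBall, C.length = p + 1 ∧ IsOrbitChain cd pT.2 (codeFun l) S C ∧
      x ∈ ((C.getD 0 default).toSet : Set X) := by
  induction p generalizing x with
  | zero =>
    obtain ⟨c, hc, hxc, -⟩ := exists_wellMarked hcd l S (x := x) (y := x) (r := 1)
      (by simp)
    exact ⟨[c], rfl, ⟨by simpa using hc, by simp⟩, hxc⟩
  | succ p ih =>
    obtain ⟨C, hCl, hC, hxC⟩ := ih (x := T x) fun k => hD (k + 1)
    obtain ⟨c, hc, hxc, hcC⟩ := exists_mapsInto hcd hpT l S hxC (hD 0)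
    refine ⟨c :: C, by simp [hCl], ⟨?_, ?_⟩, hxc⟩
    · intro b hb
      rcases List.mem_cons.1 hb with rfl | hb
      · exact hc
      · exact hC.1 b hb
    · intro k hk
      rw [List.mem_range, List.length_cons] at hk
      cases k with
      | zero => exact hcC
      | succ k =>
        have := hC.2 k (List.mem_range.2 (by omega))
        simpa using this

theorem IsOrbitChain.abs_birkhoffSum_sub_le (hcd : ComputesDist X cd)
    (hpT : DescribesAEMap μ pT T) {l : List (ℚ × List (ℕ × PosRat × PosRat))} {S : ℕ}
    (hS : 0 < S) {C : List MarkedBall} (hC : IsOrbitChain cd pT.2 (codeFun l) S C) {x : X}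
    (hx : x ∈ ((C.getD 0 default).toSet : Set X)) (hD : ∀ k, T^[k] x ∈ effectiveGδ pT.1) :
    |birkhoffSum T (idealFun l) C.length x - (C.map fun c => c.2.2.val).sum| ≤
      C.length * (1 / S) := by
  rw [sum_map_eq_sum_range C _ default, birkhoffSum, ← Finset.sum_sub_distrib]
  refine (Finset.abs_sum_le_sum_abs _ _).trans ?_
  refine (Finset.sum_le_card_nsmul _ _ (1 / (S : ℝ)) fun k hk => ?_).trans_eq (by simp)
  have hk' := Finset.mem_range.1 hk
  have hmem : C.getD k default ∈ C := by
    rw [List.getD_eq_getElem _ _ hk']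
    exact List.getElem_mem hk'
  exact ((hC.1 _ hmem).abs_sub_le hcd hS (hC.iterate_mem hcd hpT hx hD hk')).2

/-- Near a certified point the Birkhoff averages are as certified. -/
theorem abs_birkhoffAverage_sub_meanVal_le (hcd : ComputesDist X cd)
    (hpT : DescribesAEMap μ pT T) {l : List (ℚ × List (ℕ × PosRat × PosRat))} {S p : ℕ}
    (hS : 0 < S) (hp : 0 < p) {I : ℕ × ℕ} {κ : ℝ} {x y : X}
    (hy : y ∈ certifiedSet X cd pT.2 (codeFun l) S p I κ) (hxy : dist x y < κ)
    (hD : ∀ k, T^[k] x ∈ effectiveGδ pT.1) :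
    |birkhoffAverage ℝ T (idealFun l) p x - meanVal S I| ≤ 4 / S := by
  obtain ⟨C, rfl, hC, hmean, hyC⟩ := hy
  have hx : x ∈ ((C.getD 0 default).toSet : Set X) := by
    have := dist_triangle x y (ideal (C.getD 0 default).1)
    change dist x (ideal (C.getD 0 default).1) < 1 / (((C.getD 0 default).2.1 : ℝ) + 1)
    linarith
  rw [meanNear_iff hS I fun c hc => hC.denom_pos (X := X) hcd hS hc] at hmean
  have h1 := hC.abs_birkhoffSum_sub_le hcd hpT hS hx hD
  have hp' : (0 : ℝ) < C.length := by exact_mod_cast hp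
  have h2 : birkhoffAverage ℝ T (idealFun l) C.length x - meanVal S I =
      (birkhoffSum T (idealFun l) C.length x - C.length * meanVal S I) / C.length := by
    rw [birkhoffAverage, smul_eq_mul]
    field_simp
  rw [h2, abs_div, abs_of_pos hp', div_le_iff₀ hp']
  have h3 := abs_sub_le (birkhoffSum T (idealFun l) C.length x)
    ((C.map fun c => c.2.2.val).sum) (C.length * meanVal S I)
  have h4 : (4 : ℝ) / S * C.length = C.length * (1 / S) + C.length * (3 / S) := by ring
  linarith

/-- A point with averages close to the constant is certified, with some margin. -/
theorem exists_mem_certifiedSet (hcd : ComputesDist X cd) (hpT : DescribesAEMap μ pT T)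
    (l : List (ℚ × List (ℕ × PosRat × PosRat))) {S : ℕ} (hS : 0 < S) (p : ℕ) {I : ℕ × ℕ} {x : X}
    (hD : ∀ k, T^[k] x ∈ effectiveGδ pT.1)
    (hx : |birkhoffAverage ℝ T (idealFun l) (p + 1) x - meanVal S I| ≤ 2 / S) :
    ∃ m : ℕ, x ∈ certifiedSet X cd pT.2 (codeFun l) S (p + 1) I (2 * (1 / ((m : ℝ) + 1))) := by
  obtain ⟨C, hCl, hC, hxC⟩ := exists_isOrbitChain hcd hpT l S p hD
  have hxC' : dist x (ideal (C.getD 0 default).1) < 1 / (((C.getD 0 default).2.1 : ℝ) + 1) := hxC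
  obtain ⟨m, hm⟩ := exists_nat_one_div_lt (half_pos (sub_pos.2 hxC'))
  refine ⟨m, C, hCl, hC, ?_, by linarith⟩
  rw [meanNear_iff hS I fun c hc => hC.denom_pos (X := X) hcd hS hc]
  have h1 := hC.abs_birkhoffSum_sub_le hcd hpT hS hxC hD
  have hp' : (0 : ℝ) < C.length := by rw [hCl]; positivity
  rw [← hCl] at hx
  have h2 : birkhoffAverage ℝ T (idealFun l) C.length x - meanVal S I =
      (birkhoffSum T (idealFun l) C.length x - C.length * meanVal S I) / C.length := by
    rw [birkhoffAverage, smul_eq_mul]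
    field_simp
  rw [h2, abs_div, abs_of_pos hp', div_le_iff₀ hp'] at hx
  rw [abs_sub_comm] at h1
  have h3 := abs_sub_le ((C.map fun c => c.2.2.val).sum)
    (birkhoffSum T (idealFun l) C.length x) (C.length * meanVal S I)
  have h4 : (C.length : ℝ) * (3 / S) = C.length * (1 / S) + 2 / S * C.length := by ring
  linarith

end Space

/-! ### Soundness and completeness of the certificates -/

section Descriptions

variable {ι P : Type*} [Encodable ι] {pt : ι → P} {d : P → P → ℝ≥0∞} {c : Code × Code} {x : P}

theorem DescribesPoint.exists_approximates (h : DescribesPoint pt d c x) (m : ℕ) :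
    ∃ i, Approximates c m (encode i) ∧ d (pt i) x ≤ ENNReal.ofReal (1 / ((m : ℝ) + 1)) := by
  obtain ⟨A, D, hA, hD, h⟩ := h
  refine ⟨A (D (unitRat m)), ⟨D (unitRat m), ?_, hA _⟩, ?_⟩
  · rw [← encode_unitRat]
    exact hD _
  · rw [← cast_unitRat]
    exact h _ _ le_rfl

theorem DescribesPoint.le_of_approximates (h : DescribesPoint pt d c x) {m a : ℕ}
    (ha : Approximates c m a) :
    ∃ i, encode i = a ∧ d (pt i) x ≤ ENNReal.ofReal (1 / ((m : ℝ) + 1)) := by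
  obtain ⟨A, D, hA, hD, h⟩ := h
  obtain ⟨k, hk, hak⟩ := ha
  rw [← encode_unitRat] at hk
  obtain rfl := Part.mem_unique hk (hD _)
  refine ⟨_, Part.mem_unique (hA _) hak, ?_⟩
  rw [← cast_unitRat]
  exact h _ _ le_rfl

end Descriptions

section Space

variable {X : Type*} [MetricSpace X] [ComputableMetricSpace X]

theorem isOpen_effectiveOpen {ι : Type*} [Encodable ι] (c : Code) (i : ι) :
    IsOpen (effectiveOpen c i : Set X) := by
  rw [isOpen_iff_mem_nhds]
  rintro x ⟨n, b, hb, hx⟩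
  exact Filter.mem_of_superset (Metric.isOpen_ball.mem_nhds hx) fun y hy => ⟨n, b, hb, hy⟩

variable [MeasurableSpace X] [BorelSpace X] {cd : Code} {μ : Measure X} {T : X → X}
  {pT pμ : Code × Code}

open ComputableMetricSpace (ideal)

theorem measurableSet_effectiveGδ (c : Code) : MeasurableSet (effectiveGδ c : Set X) :=
  MeasurableSet.iInter fun _ => (isOpen_effectiveOpen c _).measurableSet

/-- Almost every orbit stays in the domain of computability of the map. -/
theorem ae_forall_iterate_mem [IsProbabilityMeasure μ] (hT : MeasurePreserving T μ μ)
    (hpT : DescribesAEMap μ pT T) : ∀ᵐ x ∂μ, ∀ k, T^[k] x ∈ effectiveGδ pT.1 := by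
  have h : ∀ᵐ x ∂μ, x ∈ effectiveGδ pT.1 :=
    (prob_compl_eq_zero_iff (measurableSet_effectiveGδ pT.1)).2 hpT.1
  exact ae_all_iff.2 fun k => (hT.iterate k).quasiMeasurePreserving.ae h

theorem integrable_idealFun [IsProbabilityMeasure μ]
    (l : List (ℚ × List (ℕ × PosRat × PosRat))) : Integrable (idealFun l : X → ℝ) μ :=
  Integrable.of_bound (continuous_idealFun l).measurable.aestronglyMeasurable
    (funBound (codeFun l)) (Filter.Eventually.of_forall (abs_idealFun_le l))

/-- A certificate bounds the `L¹`-distance of a Birkhoff average from a constant. -/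
theorem MostlyNear.integral_abs_sub_le [IsProbabilityMeasure μ] (hT : MeasurePreserving T μ μ)
    (hcd : ComputesDist X cd) (hpT : DescribesAEMap μ pT T) (hpμ : DescribesMeasure pμ μ)
    {l : List (ℚ × List (ℕ × PosRat × PosRat))} {S θ p : ℕ} (hS : 4 ≤ S) (hθ : 1 < θ)
    (hp : 0 < p) {I : ℕ × ℕ} (h : MostlyNear cd pT.2 pμ (codeFun l) S θ p I) :
    ∫ x, |birkhoffAverage ℝ T (idealFun l) p x - meanVal S I| ∂μ ≤
      4 / S + (2 * funBound (codeFun l) + 1) / θ := by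
  obtain ⟨m, A, G, hA, hG, hw⟩ := h
  obtain ⟨A', hA', hW⟩ := hpμ.le_of_approximates hA
  obtain rfl := encode_injective hA'
  set K : ℝ := (funBound (codeFun l) : ℝ)
  have hS0 : 0 < S := by omega
  have hS' : (4 : ℝ) ≤ S := by exact_mod_cast hS
  have hθ' : (1 : ℝ) < θ := by exact_mod_cast hθ
  have hK : ∀ x : X, |birkhoffAverage ℝ T (idealFun l) p x| ≤ K :=
    abs_birkhoffAverage_le T (abs_idealFun_le l) hp
  set κ : ℝ := 1 / ((m : ℝ) + 1) with hκ
  have hκ0 : 0 < κ := by positivity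
  let s : Set X := ideal '' {i | i ∈ G}
  have hs : MeasurableSet s := ((List.finite_toSet G).image _).measurableSet
  let U : Set X := Metric.thickening κ s
  have hU : MeasurableSet U := Metric.isOpen_thickening.measurableSet
  have hUnear : ∀ x ∈ U, (∀ k, T^[k] x ∈ effectiveGδ pT.1) →
      |birkhoffAverage ℝ T (idealFun l) p x - meanVal S I| ≤ 4 / S := by
    intro x hx hD
    obtain ⟨_, ⟨i, hi, rfl⟩, hxi⟩ := Metric.mem_thickening_iff.1 hx
    exact abs_birkhoffAverage_sub_meanVal_le hcd hpT hS0 hp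
      ((goodPoint_iff (X := X) hcd).1 (hG i hi)) hxi hD
  -- the atoms outside `s` have little weight, and `μ` is close to the ideal measure
  have hUc : μ.real Uᶜ ≤ 1 / θ := by
    have h1 : (idealMeasure A').real sᶜ ≤ 1 / (2 * θ) := by
      rw [measureReal_idealMeasure A' hs.compl]
      have hw0 : (0 : ℝ) < totalWeight A' := by exact_mod_cast totalWeight_pos A'
      rw [div_le_div_iff₀ hw0 (by positivity), one_mul]
      have h2 : weightIn sᶜ A' * (2 * θ) ≤ totalWeight A' :=
        (Nat.mul_le_mul_right _ (weightIn_le_weightOutside G A')).trans hw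
      exact_mod_cast h2
    have h2 := measureReal_le_thickening_add (by positivity) hκ0 hW hs
    have h3 : 1 / (((4 * θ * (m + 1) : ℕ) : ℝ) + 1) / κ ≤ 1 / (2 * θ) := by
      rw [hκ, div_div_eq_mul_div, div_one, div_mul_eq_mul_div, one_mul,
        div_le_div_iff₀ (by positivity) (by positivity)]
      push_cast
      nlinarith [mul_nonneg (by linarith : (0 : ℝ) ≤ θ) (by positivity : (0 : ℝ) ≤ (m : ℝ) + 1)]
    have h4 := probReal_compl_eq_one_sub (μ := idealMeasure A') hs
    have h5 := probReal_compl_eq_one_sub (μ := μ) hU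
    have h6 : (1 : ℝ) / (2 * θ) + 1 / (2 * θ) = 1 / θ := by
      have : (θ : ℝ) ≠ 0 := by linarith
      field_simp
      norm_num
    have h7 : (idealMeasure A').real s ≤ μ.real U + 1 / (((4 * θ * (m + 1) : ℕ) : ℝ) + 1) / κ := h2
    linarith
  have hD := ae_forall_iterate_mem hT hpT
  -- a certified point shows that the constant is bounded
  have hI : |meanVal S I| ≤ K + 1 := by
    by_contra hcon
    have hUae : ∀ᵐ x ∂μ, x ∈ Uᶜ := by
      filter_upwards [hD] with x hx hxU
      have h1 := hUnear x hxU hx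
      have h2 := hK x
      have h3 := abs_sub_abs_le_abs_sub (meanVal S I) (birkhoffAverage ℝ T (idealFun l) p x)
      rw [abs_sub_comm] at h3
      have h4 : (4 : ℝ) / S ≤ 1 := (div_le_one (by linarith)).2 hS'
      linarith
    have h1 : μ.real Uᶜ = 1 := by
      rw [measureReal_def, (prob_compl_eq_zero_iff hU.compl).1 hUae, ENNReal.toReal_one]
    rw [h1, le_div_iff₀ (by linarith)] at hUc
    linarith
  have hbound : ∀ᵐ x ∂μ, |birkhoffAverage ℝ T (idealFun l) p x - meanVal S I| ≤
      4 / S + Uᶜ.indicator (fun _ => 2 * K + 1) x := by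
    filter_upwards [hD] with x hx
    by_cases hxU : x ∈ U
    · rw [indicator_of_notMem (by simpa using hxU), add_zero]
      exact hUnear x hxU hx
    · rw [indicator_of_mem (by simpa using hxU)]
      have h1 := abs_sub (birkhoffAverage ℝ T (idealFun l) p x) (meanVal S I)
      have h2 := hK x
      have h3 : (0 : ℝ) ≤ 4 / S := by positivity
      linarith
  have hAi := integrable_birkhoffAverage hT (integrable_idealFun (μ := μ) l) p
  have hind : Integrable (Uᶜ.indicator fun _ => 2 * K + 1) μ :=
    (integrable_const _).indicator hU.compl
  refine (integral_mono_ae (hAi.sub (integrable_const _)).abs ((integrable_const _).add hind)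
    hbound).trans ?_
  rw [integral_add' (integrable_const _) hind, integral_indicator_const _ hU.compl, smul_eq_mul]
  have hK0 : 0 ≤ K := Nat.cast_nonneg _
  have h1 := mul_le_mul_of_nonneg_right hUc (by linarith : 0 ≤ 2 * K + 1)
  have h2 : (1 : ℝ) / θ * (2 * K + 1) = (2 * K + 1) / θ := by ring
  simp only [integral_const, probReal_univ, smul_eq_mul, one_mul]
  linarith

/-- Every real number is within `1 / S` of some constant `meanVal S I`. -/
theorem exists_meanVal_near {S : ℕ} (hS : 0 < S) (y : ℝ) :
    ∃ I : ℕ × ℕ, |y - meanVal S I| ≤ 1 / S := by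
  have hS' : (0 : ℝ) < S := by exact_mod_cast hS
  refine ⟨(⌊y * S⌋.toNat, (-⌊y * S⌋).toNat), ?_⟩
  have h1 : ((⌊y * S⌋.toNat : ℝ) - ((-⌊y * S⌋).toNat : ℝ)) = (⌊y * S⌋ : ℝ) := by
    exact_mod_cast Int.toNat_sub_toNat_neg ⌊y * S⌋
  have h2 : y - meanVal S (⌊y * S⌋.toNat, (-⌊y * S⌋).toNat) = (y * S - ⌊y * S⌋) / S := by
    rw [meanVal, h1]
    field_simp
  rw [h2, abs_div, abs_of_pos hS', div_le_div_iff_of_pos_right hS', abs_of_nonneg]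
  · linarith [Int.lt_floor_add_one (y * S)]
  · linarith [Int.floor_le (y * S)]

/-- Certificates exist: by the mean ergodic theorem some Birkhoff average is close to its integral
on most of the space, and this is seen by the ideal measures close to `μ`. -/
theorem exists_mostlyNear [IsProbabilityMeasure μ] (hT : Ergodic T μ)
    (hcd : ComputesDist X cd) (hpT : DescribesAEMap μ pT T) (hpμ : DescribesMeasure pμ μ)
    (l : List (ℚ × List (ℕ × PosRat × PosRat))) {S θ : ℕ} (hS : 0 < S) (hθ : 0 < θ) :
    ∃ (p : ℕ) (I : ℕ × ℕ), MostlyNear cd pT.2 pμ (codeFun l) S θ (p + 1) I := by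
  have hS' : (0 : ℝ) < S := by exact_mod_cast hS
  have hθ' : (0 : ℝ) < θ := by exact_mod_cast hθ
  have hg : MemLp (idealFun l : X → ℝ) 2 μ :=
    MemLp.of_bound (continuous_idealFun l).measurable.aestronglyMeasurable
      (funBound (codeFun l)) (Filter.Eventually.of_forall (abs_idealFun_le l))
  have hlim := (tendstoInMeasure_iff_dist.1 (tendstoInMeasure_birkhoffAverage hT hg))
    (1 / S) (by positivity)
  have hev := (hlim.eventually_lt_const
    (ENNReal.ofReal_pos.2 (by positivity : (0 : ℝ) < 1 / (4 * θ)))).and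
      (Filter.eventually_gt_atTop 0)
  obtain ⟨p', hp', hp0⟩ := hev.exists
  obtain ⟨p, rfl⟩ : ∃ p, p' = p + 1 := ⟨p' - 1, by omega⟩
  obtain ⟨I, hI⟩ := exists_meanVal_near hS (∫ x, idealFun l x ∂μ)
  set V : ℝ → Set X := certifiedSet X cd pT.2 (codeFun l) S (p + 1) I with hV
  have hVm : ∀ κ, MeasurableSet (V κ) := fun κ => (isOpen_certifiedSet _ _ _ _ _ _).measurableSet
  have hVmono : Monotone fun m : ℕ => V (2 * (1 / ((m : ℝ) + 1))) := by
    intro m m' hm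
    refine certifiedSet_anti _ _ _ _ _ ?_
    have : (m : ℝ) ≤ m' := by exact_mod_cast hm
    gcongr
  have hbad : μ (⋃ m : ℕ, V (2 * (1 / ((m : ℝ) + 1))))ᶜ < ENNReal.ofReal (1 / (4 * θ)) := by
    refine lt_of_le_of_lt (measure_mono_ae ?_) hp'
    filter_upwards [ae_forall_iterate_mem hT.toMeasurePreserving hpT] with x hx hxV
    by_contra hlt
    have hlt' : dist (birkhoffAverage ℝ T (idealFun l) (p + 1) x) (∫ x, idealFun l x ∂μ) <
        1 / S := not_le.1 hlt
    rw [Real.dist_eq] at hlt'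
    have h1 := abs_sub_le (birkhoffAverage ℝ T (idealFun l) (p + 1) x) (∫ x, idealFun l x ∂μ)
      (meanVal S I)
    have h2 : (2 : ℝ) / S = 1 / S + 1 / S := by ring
    obtain ⟨m, hm⟩ := exists_mem_certifiedSet hcd hpT l hS p (I := I) hx (by linarith)
    exact hxV (mem_iUnion.2 ⟨m, hm⟩)
  obtain ⟨m, hm⟩ : ∃ m : ℕ, 1 - 1 / (4 * θ) < μ.real (V (2 * (1 / ((m : ℝ) + 1)))) := by
    have h1 : 1 - 1 / (4 * (θ : ℝ)) < μ.real (⋃ m : ℕ, V (2 * (1 / ((m : ℝ) + 1)))) := by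
      have h2 := probReal_compl_eq_one_sub (μ := μ)
        (MeasurableSet.iUnion fun m : ℕ => hVm (2 * (1 / ((m : ℝ) + 1))))
      have h3 : μ.real (⋃ m : ℕ, V (2 * (1 / ((m : ℝ) + 1))))ᶜ < 1 / (4 * θ) := by
        rw [measureReal_def]
        exact (ENNReal.lt_ofReal_iff_toReal_lt (measure_ne_top _ _)).1 hbad
      linarith
    have h4 := (ENNReal.tendsto_toReal (measure_ne_top _ _)).comp
      (tendsto_measure_iUnion_atTop (μ := μ) hVmono)
    obtain ⟨m, hm⟩ := (h4.eventually_const_lt h1).exists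
    exact ⟨m, hm⟩
  obtain ⟨A, hA, hW⟩ := hpμ.exists_approximates (4 * θ * (m + 1))
  set κ : ℝ := 1 / ((m : ℝ) + 1) with hκ
  have hκ0 : 0 < κ := by positivity
  classical
  refine ⟨p, I, m, A, ((A.1 :: A.2).map Prod.snd).filter fun i => (ideal i : X) ∈ V κ, hA, ?_, ?_⟩
  · intro i hi
    rw [goodPoint_iff (X := X) hcd]
    exact of_decide_eq_true (List.mem_filter.1 hi).2
  · rw [W₁_comm] at hW
    have h1 := measureReal_le_thickening_add (by positivity) hκ0 hW (hVm (2 * κ))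
    have h2 : (idealMeasure A).real (Metric.thickening κ (V (2 * κ))) ≤
        (idealMeasure A).real (V κ) :=
      measureReal_mono (thickening_certifiedSet_subset _ _ _ _ _ _)
    have h3 : 1 / (((4 * θ * (m + 1) : ℕ) : ℝ) + 1) / κ ≤ 1 / (4 * θ) := by
      rw [hκ, div_div_eq_mul_div, div_one, div_mul_eq_mul_div, one_mul,
        div_le_div_iff₀ (by positivity) (by positivity)]
      push_cast
      linarith
    have h4 := probReal_compl_eq_one_sub (μ := idealMeasure A) (hVm κ)
    have h5 : (idealMeasure A).real (V κ)ᶜ ≤ 1 / (2 * θ) := by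
      have h6 : (1 : ℝ) / (4 * θ) + 1 / (4 * θ) = 1 / (2 * θ) := by
        field_simp
        norm_num
      linarith
    rw [measureReal_idealMeasure A (hVm κ).compl, div_le_div_iff₀
      (by exact_mod_cast totalWeight_pos A) (by positivity), one_mul] at h5
    have h7 := weightOutside_filter (V κ) A
    rw [h7]
    exact_mod_cast h5

/-- Soundness: what the search finds is a rate. -/
theorem IsCertifiedRate.measure_lt (hcd : ComputesDist X cd) {f : X → ℝ} {pf : Code × Code}
    [IsProbabilityMeasure μ] (hT : MeasurePreserving T μ μ) (hf : Integrable f μ)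
    (hpT : DescribesAEMap μ pT T) (hpμ : DescribesMeasure pμ μ) (hpf : DescribesL1 μ pf f)
    (ε δ : PosRat) {N : ℕ} (h : IsCertifiedRate cd ((pT, pμ, pf), encode ε, encode δ) N) {n : ℕ}
    (hn : N ≤ n) :
    μ {x | ENNReal.ofReal ((ε : ℚ) : ℝ) ≤
      tailSup (birkhoffAverage ℝ T f) (fun _ => ∫ y, f y ∂μ) n x} <
        ENNReal.ofReal ((δ : ℚ) : ℝ) := by
  obtain ⟨l', p, I, hl, hnear, rfl⟩ := h
  obtain ⟨l, hle, hdist⟩ := hpf.le_of_approximates hl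
  rw [← encode_codeFun] at hle
  obtain rfl := encode_injective hle
  set s := RateInput.scale ((pT, pμ, pf), encode ε, encode δ)
  have ha := denom_encode_posRat_pos ε
  have hb := denom_encode_posRat_pos δ
  have hs8 : s = 8 * denom (encode ε) * denom (encode δ) := rfl
  have hab : 0 < denom (encode ε) * denom (encode δ) := Nat.mul_pos ha hb
  have hs0 : 8 ≤ s := by rw [hs8, mul_assoc]; omega
  have hs' : (0 : ℝ) < s := by exact_mod_cast (by omega : 0 < s)
  set K := funBound (codeFun l)
  have hθ : 1 < 4 * s * (2 * K + 1) := by nlinarith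
  have hA := hnear.integral_abs_sub_le hT hcd hpT hpμ (by omega) hθ p.succ_pos
  have hg := integrable_idealFun (μ := μ) l
  have hfg := integral_abs_sub_le_of_distL1_le hf hg (by positivity) hdist
  have hη : ∫ x, |f x - idealFun l x| ∂μ +
      ∫ x, |birkhoffAverage ℝ T (idealFun l) (p + 1) x - meanVal (16 * s) I| ∂μ ≤ 1 / s := by
    have h1 : 1 / (((2 * s : ℕ) : ℝ) + 1) ≤ 1 / (2 * s) := by
      push_cast
      gcongr
      linarith
    have h2 : (4 : ℝ) / ((16 * s : ℕ) : ℝ) + (2 * K + 1) / ((4 * s * (2 * K + 1) : ℕ) : ℝ) =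
        1 / (2 * s) := by
      push_cast
      field_simp
      norm_num
    have h3 : (1 : ℝ) / (2 * s) + 1 / (2 * s) = 1 / s := by
      field_simp
      norm_num
    linarith
  have ha' : (1 : ℝ) ≤ denom (encode ε) := by exact_mod_cast ha
  have hb' : (1 : ℝ) ≤ denom (encode δ) := by exact_mod_cast hb
  have hε0 := posRat_pos ε
  have hδ0 := posRat_pos δ
  have hεa : 1 ≤ ((ε : ℚ) : ℝ) * denom (encode ε) :=
    (div_le_iff₀ (by linarith)).1 (inv_denom_le ε)
  have hδb : 1 ≤ ((δ : ℚ) : ℝ) * denom (encode δ) :=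
    (div_le_iff₀ (by linarith)).1 (inv_denom_le δ)
  have hsr : (s : ℝ) = 8 * (denom (encode ε) * denom (encode δ)) := by
    rw [hs8]; push_cast; ring
  -- as `1 / a ≤ ε` and `1 / b ≤ δ` for the denominators `a` and `b`, the error `1 / (8ab)` in `L¹`
  -- is below both `ε / 4` and `εδ / 4`
  have hηε : 1 / (s : ℝ) ≤ ((ε : ℚ) : ℝ) / 4 := by
    rw [div_le_div_iff₀ hs' (by norm_num), hsr]
    nlinarith
  have hn0 : n ≠ 0 := by omega
  have hnK : 8 * ((p + 1 : ℕ) : ℝ) * K ≤ ((ε : ℚ) : ℝ) * n := by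
    have h1 : ((8 * denom (encode ε) * (p + 1) * K + 1 : ℕ) : ℝ) ≤ n := by exact_mod_cast hn
    have h2 := mul_le_mul_of_nonneg_left h1 hε0.le
    have h3 : (0 : ℝ) ≤ 8 * ((p + 1 : ℕ) : ℝ) * K := by positivity
    have h4 := mul_le_mul_of_nonneg_right hεa h3
    push_cast at h2 h4 h3 ⊢
    nlinarith
  refine lt_of_le_of_lt (measure_le_tailSup_le hT hf hg (abs_idealFun_le l) p.succ_ne_zero hε0 hη
    hηε hn0 hnK) ((ENNReal.ofReal_lt_ofReal_iff hδ0).2 ?_)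
  rw [div_lt_iff₀ (by linarith), div_lt_iff₀ hs', hsr]
  nlinarith [mul_le_mul hεa hδb zero_le_one (by linarith)]

/-- Completeness: the search succeeds. -/
theorem exists_isCertifiedRate (hcd : ComputesDist X cd) {f : X → ℝ} {pf : Code × Code}
    [IsProbabilityMeasure μ] (hT : Ergodic T μ) (hpT : DescribesAEMap μ pT T)
    (hpμ : DescribesMeasure pμ μ) (hpf : DescribesL1 μ pf f) (ε δ : PosRat) :
    ∃ N, IsCertifiedRate cd ((pT, pμ, pf), encode ε, encode δ) N := by
  set s := RateInput.scale ((pT, pμ, pf), encode ε, encode δ)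
  have hs0 : 0 < s := Nat.mul_pos (Nat.mul_pos (by norm_num) (denom_encode_posRat_pos ε))
    (denom_encode_posRat_pos δ)
  obtain ⟨l, hl, -⟩ := hpf.exists_approximates (2 * s)
  rw [← encode_codeFun] at hl
  obtain ⟨p, I, h⟩ := exists_mostlyNear hT hcd hpT hpμ l (S := 16 * s)
    (θ := 4 * s * (2 * funBound (codeFun l) + 1)) (by omega) (by positivity)
  exact ⟨_, codeFun l, p, I, hl, h, rfl⟩

end Space

end ComputableErgodic

theorem mainTheorem1 {X : Type*} [MetricSpace X] [MeasurableSpace X] [BorelSpace X]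
    [ComputableErgodic.ComputableMetricSpace X] :
    (∀ (μ : Measure X) (T : X → X) (f : X → ℝ),
      ComputableErgodic.IsComputableErgodicSystem μ T →
      ComputableErgodic.IsL1Computable μ f →
      ComputableErgodic.EffectivelyConvergesAS μ (birkhoffAverage ℝ T f)
        (fun _ => ∫ y, f y ∂μ)) ∧
    ∃ N : Code, ∀ (μ : Measure X) (T : X → X) (f : X → ℝ) (pT pμ pf : Code × Code),
      ComputableErgodic.IsComputableErgodicSystem μ T →
      ComputableErgodic.IsL1Computable μ f →
      ComputableErgodic.DescribesAEMap μ pT T →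
      ComputableErgodic.DescribesMeasure pμ μ →
      ComputableErgodic.DescribesL1 μ pf f →
      ∃ r : ComputableErgodic.PosRat → ComputableErgodic.PosRat → ℕ,
        (∀ ε δ, r ε δ ∈ N.eval (encode ((pT, pμ, pf), (ε, δ)))) ∧
        ComputableErgodic.IsRateAS μ (birkhoffAverage ℝ T f) (fun _ => ∫ y, f y ∂μ) r := by
  obtain ⟨cd, hcd⟩ := ComputableErgodic.ComputableMetricSpace.computable_dist (X := X)
  obtain ⟨N, hN⟩ := (ComputableErgodic.isRE_isCertifiedRate cd).exists_code
  have key : ∀ (μ : Measure X) (T : X → X) (f : X → ℝ) (pT pμ pf : Code × Code),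
      ComputableErgodic.IsComputableErgodicSystem μ T →
      ComputableErgodic.IsL1Computable μ f →
      ComputableErgodic.DescribesAEMap μ pT T →
      ComputableErgodic.DescribesMeasure pμ μ →
      ComputableErgodic.DescribesL1 μ pf f →
      ∃ r : ComputableErgodic.PosRat → ComputableErgodic.PosRat → ℕ,
        (∀ ε δ, r ε δ ∈ N.eval (encode ((pT, pμ, pf), (ε, δ)))) ∧
        ComputableErgodic.IsRateAS μ (birkhoffAverage ℝ T f) (fun _ => ∫ y, f y ∂μ) r := by
    intro μ T f pT pμ pf hsys hf hpT hpμ hpf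
    have := hsys.isProbabilityMeasure
    have h := fun ε δ : ComputableErgodic.PosRat => hN ((pT, pμ, pf), encode ε, encode δ)
      (ComputableErgodic.exists_isCertifiedRate hcd hsys.ergodic hpT hpμ hpf ε δ)
    choose r hr hcert using h
    exact ⟨r, hr, fun ε δ n hn => (hcert ε δ).measure_lt hcd hsys.ergodic.toMeasurePreserving hf.1
      hpT hpμ hpf ε δ hn⟩
  refine ⟨fun μ T f hsys hf => ?_, N, key⟩
  obtain ⟨pT, hpT⟩ := hsys.computable_map
  obtain ⟨pμ, hpμ⟩ := hsys.computable_measure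
  obtain ⟨pf, hpf⟩ := hf.2
  obtain ⟨r, hr, hrate⟩ := key μ T f pT pμ pf hsys hf hpT hpμ hpf
  -- fixing the descriptions in the uniform algorithm
  refine ⟨r, ⟨Code.curry N (encode (pT, pμ, pf)), fun ε δ => ?_⟩, hrate⟩
  rw [Code.eval_curry]
  exact hr ε δ
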